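/- All graphs are finite, simple, undirected and connected; $n$ and $m$ denote the numbers of vertices and edges of a graph $G=(V,E)$, $N(t)$ the set of neighbours of a vertex $t$, and $N[t]=N(t)\cup\{t\}$. A unit interval graph is a graph whose vertices can be represented by closed intervals of equal length on the real line so that two distinct vertices are adjacent if and only if their intervals intersect. Maximum Cardinality Search (MCS) numbers an arbitrary start vertex $s$ with $1$ and then, for $i=2,\dots,n$, numbers with $i$ some unnumbered vertex that has the largest number of numbered neighbours. Lexicographic Depth First Search (LDFS) gives the label $(0)$ to an arbitrary start vertex $s$ and the empty label to all other vertices; then, for $i=1,\dots,n$, it numbers with $i$ some unnumbered vertex with lexicographically largest label and prepends $i$ to the label of each of its unnumbered neighbours. A vertex $t$ is an end-vertex of MCS (of LDFS) if some execution of the search on $G$ numbers $t$ last. The MCS (LDFS) end-vertex problem asks, given $G$ and $t\in V$, whether $t$ is an end-vertex of MCS (of LDFS). **Corollary.** On unit interval graphs, the MCS end-vertex problem and the LDFS end-vertex problem can be decided in linear time by checking whether $t$ is simplicial (that is, $N(t)$ is a clique) and $G-N[t]$ is connected (where the graph without vertices counts as connected). More precisely: there is a single program of a random access machine (unit cost per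 instruction, words of $O(\log(n+m))$ bits, instructions: constants, copying, addition, subtraction, comparison, indirect loading and storing) which, for every connected unit interval graph $G$ given by adjacency lists and every vertex $t$ of $G$, halts after $O(n+m)$ steps and answers "yes" if and only if $t$ is simplicial and $G-N[t]$ is connected; and it answers "yes" if and only if $t$ is an end-vertex of MCS, and if and only if $t$ is an end-vertex of LDFS. -/

import Mathlib

/-! ## Unit interval graphs and simplicial vertices -/

/-- The vertices can be represented by closed real intervals, all of the same length, so that two
distinct vertices are adjacent if and only if their intervals intersect. -/
def IsUnitIntervalGraph {V : Type*} (G : SimpleGraph V) : Prop :=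
  ∃ (a : V → ℝ) (ℓ : ℝ), 0 < ℓ ∧ ∀ u v : V, u ≠ v →
    (G.Adj u v ↔ (Set.Icc (a u) (a u + ℓ) ∩ Set.Icc (a v) (a v + ℓ)).Nonempty)

/-- The neighbourhood of `t` is a clique. -/
def IsSimplicialVertex {V : Type*} (G : SimpleGraph V) (t : V) : Prop :=
  G.IsClique (G.neighborSet t)

/-- `t` is simplicial and `G - N[t]` is connected, where the graph without vertices counts as
connected (it arises when `N[t]` is the whole vertex set). -/
def IsSimplicialWithConnectedRest {V : Type*} (G : SimpleGraph V) (t : V) : Prop :=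
  IsSimplicialVertex G t ∧ (G.induce (insert t (G.neighborSet t))ᶜ).Preconnected

/-! ## Graph searches and their end-vertices

A vertex ordering is a bijection `σ : V ≃ Fin (Fintype.card V)`; the vertex `v` is the vertex
numbered `σ v + 1` by the search. -/

/-- `t` is the last vertex of the ordering `σ`. -/
def IsEndVertexOf {V : Type*} [Fintype V] (σ : V ≃ Fin (Fintype.card V)) (t : V) : Prop :=
  (σ t : ℕ) + 1 = Fintype.card V

/-- The number of neighbours of `w` among the vertices at the first `i` positions. -/
noncomputable def numberedNeighbors {V : Type*} [Fintype V] (G : SimpleGraph V)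
    (σ : V ≃ Fin (Fintype.card V)) (i : ℕ) (w : V) : ℕ :=
  {u : V | (σ u : ℕ) < i ∧ G.Adj u w}.ncard

/-- `σ` is a possible output of Maximum Cardinality Search started at `s`: the first vertex is `s`,
and every later vertex has, when it is picked, the largest number of numbered neighbours among the
vertices that are not yet numbered. -/
def IsMCSOrder {V : Type*} [Fintype V] (G : SimpleGraph V) (s : V)
    (σ : V ≃ Fin (Fintype.card V)) : Prop :=
  (σ s : ℕ) = 0 ∧ ∀ v w : V, 0 < (σ v : ℕ) → σ v ≤ σ w →
    numberedNeighbors G σ (σ v) w ≤ numberedNeighbors G σ (σ v) v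

open Classical in
/-- The label of `w` in Lexicographic Depth First Search started at `s`, after the first `i`
vertices of `σ` have been numbered. Initially `s` has the label `0` and every other vertex the empty
label; when a vertex receives the number `i + 1`, this number is prepended to the label of each of
its neighbours that is still unnumbered. -/
noncomputable def ldfsLabel {V : Type*} [Fintype V] (G : SimpleGraph V) (s : V)
    (σ : V ≃ Fin (Fintype.card V)) : ℕ → V → List ℕ
  | 0, w => if w = s then [0] else []
  | i + 1, w =>
      if i < (σ w : ℕ) ∧ ∃ v : V, (σ v : ℕ) = i ∧ G.Adj v w then (i + 1) :: ldfsLabel G s σ i w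
      else ldfsLabel G s σ i w

/-- `σ` is a possible output of Lexicographic Depth First Search started at `s`: every vertex has,
when it is picked, a lexicographically largest label among the vertices that are not yet
numbered. -/
def IsLDFSOrder {V : Type*} [Fintype V] (G : SimpleGraph V) (s : V)
    (σ : V ≃ Fin (Fintype.card V)) : Prop :=
  ∀ v w : V, σ v ≤ σ w → ldfsLabel G s σ (σ v) w ≤ ldfsLabel G s σ (σ v) v

/-- The MCS end-vertex problem: some Maximum Cardinality Search of `G` ends in `t`. -/
def IsMCSEndVertex {V : Type*} [Fintype V] (G : SimpleGraph V) (t : V) : Prop :=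
  ∃ (s : V) (σ : V ≃ Fin (Fintype.card V)), IsMCSOrder G s σ ∧ IsEndVertexOf σ t

/-- The LDFS end-vertex problem: some Lexicographic Depth First Search of `G` ends in `t`. -/
def IsLDFSEndVertex {V : Type*} [Fintype V] (G : SimpleGraph V) (t : V) : Prop :=
  ∃ (s : V) (σ : V ≃ Fin (Fintype.card V)), IsLDFSOrder G s σ ∧ IsEndVertexOf σ t

/-! ## A random access machine with bounded words

Programs are while-programs over registers and a random access memory. Every instruction handles a
constant number of words, and every instruction and every evaluated test costs one step. Only
numbers of at most `W` fit into a word: an instruction that would produce a larger number cannot be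
executed. -/

/-- The contents of the registers and of the memory. -/
structure RamState where
  reg : ℕ → ℕ
  mem : ℕ → ℕ

/-- Elementary instructions; the arguments are register numbers, except for the constant `c`. -/
inductive RamInstr where
  | const (d c : ℕ)
  | move (d a : ℕ)
  | add (d a b : ℕ)
  | sub (d a b : ℕ)
  | load (d a : ℕ)
  | store (a b : ℕ)

/-- Overwrite register `d` by `x`. -/
def RamState.setReg (S : RamState) (d x : ℕ) : RamState :=
  { S with reg := Function.update S.reg d x }

/-- Overwrite the memory cell `p` by `x`. -/
def RamState.setMem (S : RamState) (p x : ℕ) : RamState :=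
  { S with mem := Function.update S.mem p x }

/-- The number that an instruction writes. Subtraction is truncated at `0`. -/
def RamInstr.value : RamInstr → RamState → ℕ
  | .const _ c, _ => c
  | .move _ a, S => S.reg a
  | .add _ a b, S => S.reg a + S.reg b
  | .sub _ a b, S => S.reg a - S.reg b
  | .load _ a, S => S.mem (S.reg a)
  | .store _ b, S => S.reg b

/-- The state after an instruction: `store a b` writes register `b` into the memory cell whose
address is in register `a`; every other instruction writes into its first register. -/
def RamInstr.apply (I : RamInstr) (S : RamState) : RamState :=
  match I with
  | .const d _ => S.setReg d (I.value S)
  | .move d _ => S.setReg d (I.value S)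
  | .add d _ _ => S.setReg d (I.value S)
  | .sub d _ _ => S.setReg d (I.value S)
  | .load d _ => S.setReg d (I.value S)
  | .store a _ => S.setMem (S.reg a) (I.value S)

/-- Comparisons of two registers. -/
inductive RamTest where
  | lt (a b : ℕ)
  | eq (a b : ℕ)

/-- The comparison succeeds. -/
def RamTest.Holds : RamTest → RamState → Prop
  | .lt a b, S => S.reg a < S.reg b
  | .eq a b, S => S.reg a = S.reg b

/-- Programs. -/
inductive RamProgram where
  | skip
  | instr (I : RamInstr)
  | seq (P Q : RamProgram)
  | ite (b : RamTest) (P Q : RamProgram)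
  | while (b : RamTest) (P : RamProgram)

/-- `RamExec W P S T S'`: with words holding the numbers `0, …, W`, the program `P` started in the
state `S` halts after exactly `T` steps in the state `S'`. -/
inductive RamExec (W : ℕ) : RamProgram → RamState → ℕ → RamState → Prop
  | skip (S : RamState) : RamExec W .skip S 0 S
  | instr (I : RamInstr) (S : RamState) (h : I.value S ≤ W) :
      RamExec W (.instr I) S 1 (I.apply S)
  | seq {P Q : RamProgram} {S S' S'' : RamState} {T T' : ℕ}
      (hP : RamExec W P S T S') (hQ : RamExec W Q S' T' S'') :
      RamExec W (.seq P Q) S (T + T') S''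
  | ite_true {b : RamTest} {P Q : RamProgram} {S S' : RamState} {T : ℕ}
      (hb : b.Holds S) (hP : RamExec W P S T S') : RamExec W (.ite b P Q) S (T + 1) S'
  | ite_false {b : RamTest} {P Q : RamProgram} {S S' : RamState} {T : ℕ}
      (hb : ¬ b.Holds S) (hQ : RamExec W Q S T S') : RamExec W (.ite b P Q) S (T + 1) S'
  | while_false {b : RamTest} {P : RamProgram} {S : RamState}
      (hb : ¬ b.Holds S) : RamExec W (.while b P) S 1 S
  | while_true {b : RamTest} {P : RamProgram} {S S' S'' : RamState} {T T' : ℕ}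
      (hb : b.Holds S) (hP : RamExec W P S T S') (hrest : RamExec W (.while b P) S' T' S'') :
      RamExec W (.while b P) S (T + T' + 1) S''

/-! ## Decision problems for a graph with a distinguished vertex -/

/-- `adj` lists the neighbours of every vertex, without repetition and in an arbitrary order. -/
def IsAdjacencyList {n : ℕ} (G : SimpleGraph (Fin n)) (adj : Fin n → List (Fin n)) : Prop :=
  ∀ v : Fin n, (adj v).Nodup ∧ ∀ w : Fin n, w ∈ adj v ↔ G.Adj v w

/-- The input as a sequence of numbers: the number `n` of vertices, the vertex `t`, then `n + 1`
addresses `p 0, …, p n`, then the concatenated adjacency lists. The list of the vertex `v` occupies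
the cells `p v, …, p (v + 1) - 1`, when the sequence is stored from cell `0` on. -/
def graphInput {n : ℕ} (adj : Fin n → List (Fin n)) (t : Fin n) : List ℕ :=
  [n, (t : ℕ)]
    ++ (List.range (n + 1)).map
        (fun k => n + 3 + ((List.ofFn fun v => (adj v).length).take k).sum)
    ++ (List.ofFn adj).flatten.map Fin.val

/-- The memory holds the input, from cell `0` on; everything else is `0`. -/
def initialState (input : List ℕ) : RamState where
  reg := fun _ => 0
  mem := fun i => input.getD i 0

/-- The program `P` decides the problem `Q` in time linear in `n + m` on the connected graphs of the
class `K`: there is a constant `C` such that on every graph of the class with `n` vertices and `m`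
edges, on every vertex `t` and for every choice of adjacency lists, `P` halts after at most
`C (n + m)` steps, with words that hold the numbers up to `C (n + m)` (thus of `O(log (n + m))`
bits), and with the answer, `1` for yes and `0` for no, in register `0`. -/
def DecidesInLinearTime (P : RamProgram) (K : ∀ n : ℕ, SimpleGraph (Fin n) → Prop)
    (Q : ∀ n : ℕ, SimpleGraph (Fin n) → Fin n → Prop) : Prop :=
  ∃ C : ℕ, ∀ (n : ℕ) (G : SimpleGraph (Fin n)) (t : Fin n) (adj : Fin n → List (Fin n)),
    G.Connected → K n G → IsAdjacencyList G adj →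
      ∃ (T : ℕ) (S : RamState),
        RamExec (C * (n + G.edgeSet.ncard)) P (initialState (graphInput adj t)) T S ∧
        T ≤ C * (n + G.edgeSet.ncard) ∧
        (Q n G t → S.reg 0 = 1) ∧ (¬ Q n G t → S.reg 0 = 0)

/-! ## Unit interval graphs as indifference graphs -/

/-! Intervals are replaced by their left endpoints, so that adjacency means distance at most `ℓ`.
Being an MCS end-vertex, being an LDFS end-vertex and being simplicial with connected rest all turn
out to say that `t` is extreme: up to reflecting the line, every vertex of `N[t]` reaches the
rightmost vertex (`IsRightEnd`).

Connected rest: an edge of `G - N[t]` passing over `t` would be longer than `2ℓ`, so a connected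
rest lies on one side of `t`. Conversely, removing the closed neighbourhood of a right end leaves a
left segment, and left segments of a connected graph are connected
(`simplicialWithConnectedRest_iff`).

Searches: MCS and LDFS orders are both maximal neighbourhood orders, and the last vertex of such an
order is extreme (`isRightEnd_or_of_mns`). Conversely, an extreme `t` can be moved to the end of the
line without changing the graph. Listing the vertices towards `t` then gives an order in which the
picked vertex always has the greatest set of numbered neighbours, which is legal for both searches
(`exists_greatestNbhdOrder`).

Algorithm: let `s` have maximum degree in `N[t]`. Then `t` is extreme if and only if `N[t]` is a
clique and every vertex outside `N[t]` with a neighbour in `N(t)` is adjacent to `s`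
(`simplicialWithConnectedRest_iff_covered`). If `t` is extreme, the vertices of `N[t]` differ only
in how far they reach away from the end, and `s` reaches farthest. If vertices remain on both sides,
`s` would have two neighbours more than `2ℓ` apart on either side of `t`. The test only marks and
counts along the lists of `N[t]`, so no search of `G - N[t]` is needed and the cost is bounded by a
sum of degrees. -/

/-- Two distinct vertices are adjacent if and only if their values differ by at most `ℓ`. -/
def IsIndifferenceRep {V : Type*} (G : SimpleGraph V) (a : V → ℝ) (ℓ : ℝ) : Prop :=
  0 < ℓ ∧ ∀ u v : V, G.Adj u v ↔ u ≠ v ∧ a u ≤ a v + ℓ ∧ a v ≤ a u + ℓ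

theorem IsUnitIntervalGraph.exists_indifferenceRep {V : Type*} {G : SimpleGraph V}
    (hG : IsUnitIntervalGraph G) : ∃ a ℓ, IsIndifferenceRep G a ℓ := by
  obtain ⟨a, ℓ, hl, h⟩ := hG
  refine ⟨a, ℓ, hl, fun u v => ?_⟩
  by_cases huv : u = v
  · simp [huv]
  rw [h u v huv, Set.Icc_inter_Icc, Set.nonempty_Icc]
  simp only [le_inf_iff, sup_le_iff]
  constructor
  · rintro ⟨⟨_, h1⟩, h2, _⟩
    exact ⟨huv, by linarith, by linarith⟩
  · rintro ⟨_, h1, h2⟩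
    exact ⟨⟨by linarith, by linarith⟩, by linarith, by linarith⟩

/-- Every vertex of the closed neighbourhood of `t` lies within `ℓ` of every vertex to its
right. -/
def IsRightEnd {V : Type*} (a : V → ℝ) (ℓ : ℝ) (t : V) : Prop :=
  ∀ u v : V, a u ≤ a t + ℓ → a t ≤ a u + ℓ → a v ≤ a u + ℓ

/-- All geometric uses of connectivity go through such a boundary edge. -/
theorem exists_adj_of_not {V : Type*} {G : SimpleGraph V} (hG : G.Preconnected) (P : V → Prop)
    {u v : V} (hu : P u) (hv : ¬ P v) : ∃ x y, G.Adj x y ∧ P x ∧ ¬ P y := by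
  obtain ⟨p⟩ := hG u v
  obtain ⟨d, -, h1, h2⟩ := p.exists_boundary_dart {x | P x} hu hv
  exact ⟨d.fst, d.snd, d.adj, h1, h2⟩

namespace IsIndifferenceRep

variable {V : Type*} {G : SimpleGraph V} {a : V → ℝ} {ℓ : ℝ} {t : V}

/-- Reflection exchanges left and right ends, so arguments are written for one side only. -/
theorem neg (h : IsIndifferenceRep G a ℓ) : IsIndifferenceRep G (fun v => - a v) ℓ := by
  refine ⟨h.1, fun u v => (h.2 u v).trans ?_⟩
  constructor
  · rintro ⟨h0, h1, h2⟩
    exact ⟨h0, by linarith, by linarith⟩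
  · rintro ⟨h0, h1, h2⟩
    exact ⟨h0, by linarith, by linarith⟩

/-- An edge leaving `{v | a v ≤ a u}` starts at or left of `u`, so `u` is adjacent to its right end
`q` as well. If `q` overshoots `w`, then `w` lies between `u` and `q`. -/
theorem exists_step (h : IsIndifferenceRep G a ℓ) (hG : G.Preconnected) {u w : V}
    (huw : a u < a w) : G.Adj u w ∨ ∃ q, G.Adj u q ∧ a u < a q ∧ a q ≤ a w := by
  obtain ⟨p, q, hpq, hp, hq⟩ := exists_adj_of_not hG (fun v => a v ≤ a u) (u := u) (v := w) le_rfl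
    (not_le.2 huw)
  rw [h.2] at hpq
  push Not at hq
  have huq : G.Adj u q := (h.2 _ _).2 ⟨by rintro rfl; exact lt_irrefl _ hq,
    by linarith [h.1], by linarith⟩
  by_cases hqw : a q ≤ a w
  · exact Or.inr ⟨q, huq, hq, hqw⟩
  · push Not at hqw
    exact Or.inl ((h.2 _ _).2 ⟨by rintro rfl; exact lt_irrefl _ huw,
      by linarith [h.1], by linarith [((h.2 _ _).1 huq).2.2]⟩)

/-- Steps to the right that never pass `w` stay in `A`, and the number `N` of vertices further right
decreases. -/
theorem reachable_induce_below [Finite V] (h : IsIndifferenceRep G a ℓ) (hG : G.Preconnected)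
    {A : Set V} (hA : ∀ u w, a u ≤ a w → w ∈ A → u ∈ A) {w : V} (hw : w ∈ A) (N : ℕ) :
    ∀ (u : V) (hu : u ∈ A), a u ≤ a w → {z | a u < a z}.ncard = N →
      (G.induce A).Reachable ⟨u, hu⟩ ⟨w, hw⟩ := by
  induction N using Nat.strong_induction_on with
  | _ N ih =>
    intro u hu huw hN
    by_cases heq : u = w
    · subst heq
      exact SimpleGraph.Reachable.refl _
    rcases huw.eq_or_lt with huw | huw
    · refine SimpleGraph.Adj.reachable ?_
      have huw' : G.Adj u w := (h.2 _ _).2 ⟨heq, by linarith [h.1], by linarith [h.1]⟩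
      exact huw'
    rcases h.exists_step hG huw with hadj | ⟨q, huq, h1, h2⟩
    · exact SimpleGraph.Adj.reachable (by exact hadj)
    · have hlt : {z | a q < a z}.ncard < N := by
        rw [← hN]
        refine Set.ncard_lt_ncard ⟨fun z hz => h1.trans hz, fun hss => ?_⟩ (Set.toFinite _)
        exact lt_irrefl (a q) (hss (a := q) h1)
      refine SimpleGraph.Reachable.trans (SimpleGraph.Adj.reachable ?_)
        (ih _ hlt q (hA _ _ h2 hw) h2 rfl)
      exact huq

theorem preconnected_induce_below [Finite V] (h : IsIndifferenceRep G a ℓ) (hG : G.Preconnected)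
    {A : Set V} (hA : ∀ u w, a u ≤ a w → w ∈ A → u ∈ A) : (G.induce A).Preconnected := by
  rintro ⟨u, hu⟩ ⟨w, hw⟩
  rcases le_total (a u) (a w) with huw | huw
  · exact h.reachable_induce_below hG hA hw _ u hu huw rfl
  · exact (h.reachable_induce_below hG hA hu _ w hw huw rfl).symm

theorem mem_closedNbhd (h : IsIndifferenceRep G a ℓ) {v : V} :
    v ∈ insert t (G.neighborSet t) ↔ a v ≤ a t + ℓ ∧ a t ≤ a v + ℓ := by
  rw [Set.mem_insert_iff, SimpleGraph.mem_neighborSet, h.2]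
  constructor
  · rintro (rfl | ⟨-, h1, h2⟩)
    · exact ⟨by linarith [h.1], by linarith [h.1]⟩
    · exact ⟨h2, h1⟩
  · rintro ⟨h1, h2⟩
    by_cases hv : v = t
    · exact Or.inl hv
    · exact Or.inr ⟨Ne.symm hv, h2, h1⟩

theorem simplicial_of_isRightEnd [Finite V] (h : IsIndifferenceRep G a ℓ) (hG : G.Preconnected)
    (ht : IsRightEnd a ℓ t) : IsSimplicialWithConnectedRest G t := by
  constructor
  · intro u hu w hw huw
    have hu' := h.mem_closedNbhd.1 (Set.mem_insert_of_mem _ hu)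
    have hw' := h.mem_closedNbhd.1 (Set.mem_insert_of_mem _ hw)
    exact (h.2 _ _).2 ⟨huw, ht w u hw'.1 hw'.2, ht u w hu'.1 hu'.2⟩
  · refine h.preconnected_induce_below hG fun u w huw hw hu => hw ?_
    rw [h.mem_closedNbhd] at hu ⊢
    have h1 := ht u w hu.1 hu.2
    have h2 := ht t w (by linarith [h.1]) (by linarith [h.1])
    exact ⟨h2, by linarith⟩

/-- On the side where nothing escapes `N[t]`, every vertex belongs to the clique and is within `ℓ`
of all of `N[t]`. The first alternative of `hside` yields a left end, the second a right end. -/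
theorem isRightEnd_or_of_oneSided (h : IsIndifferenceRep G a ℓ) (hs : IsSimplicialVertex G t)
    (hside : (∀ p, a t ≤ a p + ℓ) ∨ ∀ q, a q ≤ a t + ℓ) :
    IsRightEnd a ℓ t ∨ IsRightEnd (fun v => - a v) ℓ t := by
  have key : ∀ u v, a u ≤ a t + ℓ → a t ≤ a u + ℓ → a v ≤ a t + ℓ → a t ≤ a v + ℓ →
      a v ≤ a u + ℓ := by
    intro u v hu hu' hv hv'
    have h1 := h.mem_closedNbhd.2 ⟨hu, hu'⟩
    have h2 := h.mem_closedNbhd.2 ⟨hv, hv'⟩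
    rcases h1 with rfl | h1
    · exact hv
    rcases h2 with rfl | h2
    · exact hu'
    by_cases huv : u = v
    · rw [huv]; linarith [h.1]
    · exact ((h.2 _ _).1 (hs h1 h2 huv)).2.2
  rcases hside with hp | hq
  · right
    intro u v hu hu'
    have hu1 : a t ≤ a u + ℓ := by linarith
    have hu2 : a u ≤ a t + ℓ := by linarith
    by_cases hv : a v ≤ a t + ℓ
    · have := key v u hv (hp v) hu2 hu1
      linarith
    · linarith [h.1]
  · left
    intro u v hu hu'
    by_cases hv : a t ≤ a v + ℓ
    · exact key u v hu hu' (hq v) hv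
    · linarith [h.1]

theorem simplicialWithConnectedRest_iff [Finite V] (h : IsIndifferenceRep G a ℓ)
    (hG : G.Preconnected) : IsSimplicialWithConnectedRest G t ↔
      IsRightEnd a ℓ t ∨ IsRightEnd (fun v => - a v) ℓ t := by
  constructor
  · rintro ⟨hs, hc⟩
    refine h.isRightEnd_or_of_oneSided hs ?_
    by_contra! hcon
    obtain ⟨⟨p, hp⟩, q, hq⟩ := hcon
    have hpm : p ∈ (insert t (G.neighborSet t))ᶜ := fun hm => by
      linarith [(h.mem_closedNbhd.1 hm).2]
    have hqm : q ∈ (insert t (G.neighborSet t))ᶜ := fun hm => by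
      linarith [(h.mem_closedNbhd.1 hm).1]
    -- An edge of `G - N[t]` passing over `t`; its ends would differ by more than `2ℓ`.
    obtain ⟨⟨x, hx⟩, ⟨y, hy⟩, hxy, hx', hy'⟩ := exists_adj_of_not hc (fun z => a z.1 ≤ a t)
      (u := ⟨p, hpm⟩) (v := ⟨q, hqm⟩) (by dsimp only; linarith [h.1])
      (by dsimp only; linarith [h.1])
    have hxy' := (h.2 x y).1 hxy
    have hx2 : ¬ (a x ≤ a t + ℓ ∧ a t ≤ a x + ℓ) := fun hm => hx (h.mem_closedNbhd.2 hm)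
    have hy2 : ¬ (a y ≤ a t + ℓ ∧ a t ≤ a y + ℓ) := fun hm => hy (h.mem_closedNbhd.2 hm)
    dsimp only at hx' hy'
    push Not at hy'
    apply hx2
    refine ⟨by linarith [h.1], ?_⟩
    by_contra hlt
    apply hy2
    exact ⟨by linarith [h.1], by linarith [h.1]⟩
  · rintro (hr | hr)
    · exact h.simplicial_of_isRightEnd hG hr
    · exact h.neg.simplicial_of_isRightEnd hG hr

end IsIndifferenceRep

/-! ## Maximal neighbourhood orders -/

/-- When a vertex is picked, no vertex that is not yet numbered has a strictly larger set of
numbered neighbours. -/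
def IsMNSOrder {V : Type*} [Fintype V] (G : SimpleGraph V) (σ : V ≃ Fin (Fintype.card V)) : Prop :=
  ∀ v w : V, σ v ≤ σ w → (∀ u, σ u < σ v → G.Adj u v → G.Adj u w) →
    ∀ u, σ u < σ v → G.Adj u w → G.Adj u v

theorem exists_first {V : Type*} [Fintype V] (σ : V ≃ Fin (Fintype.card V)) (P : V → Prop)
    {v : V} (hv : P v) : ∃ x, P x ∧ ∀ y, σ y < σ x → ¬ P y := by
  obtain ⟨x, hx, hmin⟩ := Set.exists_min_image {x | P x} σ (Set.toFinite _) ⟨v, hv⟩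
  exact ⟨x, hx, fun y hy hPy => absurd (hmin y hPy) (not_le.2 hy)⟩

theorem IsMNSOrder.exists_earlier_neighbor {V : Type*} [Fintype V] {G : SimpleGraph V}
    {σ : V ≃ Fin (Fintype.card V)} (hσ : IsMNSOrder G σ) (hG : G.Preconnected) {v s : V}
    (hs : σ s < σ v) : ∃ u, σ u < σ v ∧ G.Adj u v := by
  by_contra! hcon
  obtain ⟨x, y, hxy, hx, hy⟩ := exists_adj_of_not hG (fun z => σ z < σ v) hs (lt_irrefl (σ v))
  exact hcon x hx (hσ v y (not_lt.1 hy) (fun u hu hu' => absurd hu' (hcon u hu)) x hx hxy)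

namespace IsIndifferenceRep

variable {V : Type*} [Fintype V] {G : SimpleGraph V} {a : V → ℝ} {ℓ : ℝ} {t : V}
  {σ : V ≃ Fin (Fintype.card V)}

/-- Here `γ` is the first vertex outside the open range between `x` and `y`, on the left side, and
`β` will be the first vertex too far right for `x`. Maximality of `β` against `t` and `x` leaves `x`
without numbered neighbours to its left, although the search has crossed the position of `x`. -/
theorem false_of_mns_of_left_first (h : IsIndifferenceRep G a ℓ) (hG : G.Preconnected)
    (hσ : IsMNSOrder G σ) (ht : ∀ v, σ v ≤ σ t) {x y γ z : V}
    (hx : a x ≤ a t + ℓ ∧ a t ≤ a x + ℓ) (hy : a y ≤ a t + ℓ ∧ a t ≤ a y + ℓ)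
    (hxmin : ∀ u, a u ≤ a t + ℓ → a t ≤ a u + ℓ → a x ≤ a u) (hxt : a x < a t)
    (hz : a x + ℓ < a z)
    (hγx : a γ ≤ a x) (hγ : ∀ u, σ u < σ γ → a x < a u ∧ a u < a y) : False := by
  have hl := h.1
  have hlt : ∀ u, u ≠ t → σ u < σ t := fun u hu =>
    lt_of_le_of_ne (ht u) fun he => hu (σ.injective he)
  -- The vertex `t` sees everything numbered before `γ`, so maximality forces `γ` to see it too.
  have hcliq : ∀ u, σ u < σ γ → G.Adj u γ := fun u hu =>
    hσ γ t (ht γ) (fun v hv _ => (h.2 _ _).2 ⟨by rintro rfl; exact absurd (ht γ) (not_le.2 hv),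
      by linarith [(hγ v hv).2], by linarith [(hγ v hv).1]⟩) u hu
      ((h.2 _ _).2 ⟨by rintro rfl; exact absurd (ht γ) (not_le.2 hu),
        by linarith [(hγ u hu).2], by linarith [(hγ u hu).1]⟩)
  obtain ⟨β, hβ, hβfirst⟩ := exists_first σ (fun v => a x + ℓ < a v) hz
  have hβt : σ β < σ t := hlt β (by rintro rfl; linarith)
  have hγβ : σ γ < σ β := by
    by_contra hcon
    rcases (not_lt.1 hcon).eq_or_lt with he | hlt'
    · rw [σ.injective he] at hβ; linarith
    · have := ((h.2 _ _).1 (hcliq β hlt')).2.1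
      linarith
  have hS : ∀ u, σ u < σ β → a u ≤ a x + ℓ := fun u hu => not_lt.1 (hβfirst u hu)
  have hβN : ∀ u, σ u < σ β → G.Adj u β → G.Adj u t := fun u hu hadj =>
    (h.2 _ _).2 ⟨by rintro rfl; exact absurd (hu.trans hβt) (lt_irrefl _),
      by linarith [hS u hu], by linarith [((h.2 _ _).1 hadj).2.2]⟩
  -- Together with `hβN`: when `β` is picked, `β` and `t` have the same numbered neighbours.
  have htN := hσ β t hβt.le hβN
  have hxβ : ¬ G.Adj x β := fun hadj => by linarith [((h.2 _ _).1 hadj).2.2]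
  have hxS : ¬ σ x < σ β := fun hxS => hxβ (htN x hxS ((h.2 _ _).2
    ⟨by rintro rfl; exact lt_irrefl _ hxt, by linarith, by linarith⟩))
  have hne : ∀ u, σ u < σ β → u ≠ x := by
    rintro u hu rfl
    exact hxS hu
  have htx : ∀ u, σ u < σ β → G.Adj u t → G.Adj u x := fun u hu hadj => by
    have hadj' := (h.2 _ _).1 hadj
    exact (h.2 _ _).2 ⟨hne u hu, hS u hu, by
      linarith [hxmin u (by linarith) (by linarith)]⟩
  -- The unnumbered `x` sees all numbered neighbours of `β`, so by maximality it has no others.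
  have hxN := hσ β x (not_lt.1 hxS) (fun u hu hadj => htx u hu (hβN u hu hadj))
  have hnone : ∀ u, σ u < σ β → G.Adj u x → a x ≤ a u := fun u hu hadj => by
    have := (h.2 _ _).1 (hβN u hu (hxN u hu hadj))
    exact hxmin u (by linarith) (by linarith)
  have hγlt : a γ < a x := by
    refine lt_of_le_of_ne hγx fun he => ?_
    have := (h.2 γ β).1 (htN γ hγβ ((h.2 _ _).2 ⟨by rintro rfl; linarith, by linarith,
      by linarith⟩))
    linarith
  -- The vertices up to `β` lie on both sides of `x`. One numbered left of `x` reaches `w`, which is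
  -- at or beyond `x`, so it is adjacent to `x`.
  obtain ⟨w, hw, hwfirst⟩ := exists_first σ (fun v => a x ≤ a v) (v := β) (by linarith)
  have hwβ : σ w ≤ σ β := by
    by_contra hcon
    exact hwfirst β (not_le.1 hcon) (by linarith)
  obtain ⟨u, huβ, hux, huw⟩ : ∃ u, σ u < σ β ∧ a u < a x ∧ a w ≤ a u + ℓ := by
    rcases lt_trichotomy (σ w) (σ γ) with hwγ | hwγ | hwγ
    · exact ⟨γ, hγβ, hγlt, ((h.2 _ _).1 (hcliq w hwγ)).2.1⟩
    · rw [σ.injective hwγ] at hw; linarith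
    · obtain ⟨u, hu, huw⟩ := hσ.exists_earlier_neighbor hG hwγ
      exact ⟨u, hu.trans_le hwβ, not_le.1 (hwfirst u hu), ((h.2 _ _).1 huw).2.2⟩
  have := hnone u huβ ((h.2 _ _).2 ⟨hne u huβ, by linarith, by linarith⟩)
  linarith

/-- With `x` and `y` the outermost vertices of `N[t]`, the first numbered vertex not strictly
between them lies on one of the two sides, and reflection reduces both cases to
`false_of_mns_of_left_first`. -/
theorem isRightEnd_or_of_mns (h : IsIndifferenceRep G a ℓ) (hG : G.Preconnected)
    (hσ : IsMNSOrder G σ) (ht : ∀ v, σ v ≤ σ t) :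
    IsRightEnd a ℓ t ∨ IsRightEnd (fun v => - a v) ℓ t := by
  have hl := h.1
  by_contra hcon
  unfold IsRightEnd at hcon
  push Not at hcon
  obtain ⟨⟨u, z, hu1, hu2, hz⟩, u', z', hu1', hu2', hz'⟩ := hcon
  have hne : {v | a v ≤ a t + ℓ ∧ a t ≤ a v + ℓ}.Nonempty := ⟨u, hu1, hu2⟩
  obtain ⟨x, hx, hxmin⟩ := Set.exists_min_image _ a (Set.toFinite _) hne
  obtain ⟨y, hy, hymax⟩ := Set.exists_max_image _ a (Set.toFinite _) hne
  have hxu := hxmin u ⟨hu1, hu2⟩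
  have huy := hymax u' ⟨by linarith, by linarith⟩
  -- Otherwise a step from `t` towards `z'` finds a vertex of `N[t]` further left than `x`.
  have hxt : a x < a t := by
    by_contra hcon
    rcases h.neg.exists_step hG (u := t) (w := z') (by linarith) with hadj | ⟨q, hq, hq', -⟩
    · have := (h.2 _ _).1 hadj
      linarith [hxmin z' ⟨by linarith, by linarith⟩]
    · have := (h.2 _ _).1 hq
      linarith [hxmin q ⟨by linarith, by linarith⟩]
  have hty : a t < a y := by
    by_contra hcon
    rcases h.exists_step hG (u := t) (w := z) (by linarith) with hadj | ⟨q, hq, hq', -⟩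
    · have := (h.2 _ _).1 hadj
      linarith [hymax z ⟨by linarith, by linarith⟩]
    · have := (h.2 _ _).1 hq
      linarith [hymax q ⟨by linarith, by linarith⟩]
  obtain ⟨γ, hγ, hγfirst⟩ := exists_first σ (fun v => a v ≤ a x ∨ a y ≤ a v) (v := x)
    (Or.inl le_rfl)
  push Not at hγfirst
  rcases hγ with hγ | hγ
  · exact h.false_of_mns_of_left_first hG hσ ht hx hy (fun v h1 h2 => hxmin v ⟨h1, h2⟩) hxt
      (z := z) (by linarith) hγ hγfirst
  · refine h.neg.false_of_mns_of_left_first hG hσ ht (x := y) (y := x) (z := z') (γ := γ)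
      ⟨by linarith [hy.2], by linarith [hy.1]⟩ ⟨by linarith [hx.2], by linarith [hx.1]⟩
      (fun v h1 h2 => ?_) (by linarith) (by linarith) (by linarith) (fun v hv => ?_)
    · linarith [hymax v ⟨by linarith, by linarith⟩]
    · have := hγfirst v hv
      exact ⟨by linarith, by linarith⟩

end IsIndifferenceRep

/-! ## Maximum Cardinality Search and Lexicographic Depth First Search -/

section Searches

variable {V : Type*} [Fintype V] {G : SimpleGraph V} {s : V} {σ : V ≃ Fin (Fintype.card V)}

theorem IsMCSOrder.isMNSOrder (h : IsMCSOrder G s σ) : IsMNSOrder G σ := by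
  intro v w hvw hsub u hu huw
  by_contra huv
  have hpos : 0 < (σ v : ℕ) := lt_of_le_of_lt (Nat.zero_le _) hu
  refine absurd (h.2 v w hpos hvw) (not_le.2 ?_)
  refine Set.ncard_lt_ncard ⟨fun x hx => ⟨hx.1, hsub x hx.1 hx.2⟩, fun hss => ?_⟩ (Set.toFinite _)
  exact huv (hss (a := u) ⟨hu, huw⟩).2

theorem le_of_mem_ldfsLabel (i : ℕ) (w : V) : ∀ x ∈ ldfsLabel G s σ i w, x ≤ i := by
  induction i with
  | zero => intro x; simp only [ldfsLabel]; split_ifs <;> simp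
  | succ i ih =>
    intro x hx
    simp only [ldfsLabel] at hx
    split_ifs at hx
    · rcases List.mem_cons.1 hx with rfl | hx
      · exact le_rfl
      · exact (ih x hx).trans (Nat.le_succ i)
    · exact (ih x hx).trans (Nat.le_succ i)

/-- Old entries are at most `i`, so the new number wins at the first position. -/
theorem ldfsLabel_lt_cons (i : ℕ) (w : V) (L : List ℕ) : ldfsLabel G s σ i w < (i + 1) :: L := by
  cases hl : ldfsLabel G s σ i w with
  | nil => exact List.nil_lt_cons _ _
  | cons x l =>
    have := le_of_mem_ldfsLabel (G := G) (s := s) (σ := σ) i w x (by rw [hl]; exact List.mem_cons_self)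
    exact List.cons_lt_cons_iff.2 (Or.inl (Nat.lt_succ_of_le this))

theorem ldfsLabel_succ_of_adj {i : ℕ} {u w : V} (hu : (σ u : ℕ) = i) (hw : i < (σ w : ℕ))
    (huw : G.Adj u w) : ldfsLabel G s σ (i + 1) w = (i + 1) :: ldfsLabel G s σ i w := by
  simp only [ldfsLabel]
  rw [if_pos ⟨hw, u, hu, huw⟩]

theorem ldfsLabel_succ_of_not_adj {i : ℕ} {u w : V} (hu : (σ u : ℕ) = i)
    (huw : ¬ G.Adj u w) : ldfsLabel G s σ (i + 1) w = ldfsLabel G s σ i w := by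
  simp only [ldfsLabel]
  rw [if_neg]
  rintro ⟨-, u', hu', hadj⟩
  have : u' = u := σ.injective (Fin.ext (hu'.trans hu.symm))
  exact huw (this ▸ hadj)

/-- The newest number decides the comparison, and older entries matter only in a tie. The strict
part makes LDFS orders maximal neighbourhood orders; the weak part turns greatest neighbourhood
orders into LDFS orders. The start vertex is excluded because of its initial entry `0`. -/
theorem ldfsLabel_mono {v w : V} (hv : v ≠ s) (hw : w ≠ s) (i : ℕ) (hiv : i ≤ (σ v : ℕ))
    (hiw : i ≤ (σ w : ℕ)) (hsub : ∀ u, (σ u : ℕ) < i → G.Adj u w → G.Adj u v) :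
    ldfsLabel G s σ i w ≤ ldfsLabel G s σ i v ∧
      ((∃ u, (σ u : ℕ) < i ∧ G.Adj u v ∧ ¬ G.Adj u w) →
        ldfsLabel G s σ i w < ldfsLabel G s σ i v) := by
  induction i with
  | zero => simp [ldfsLabel, hv, hw]
  | succ i ih =>
    obtain ⟨ih1, ih2⟩ := ih (by omega) (by omega) fun u hu => hsub u (by omega)
    obtain ⟨u, hu⟩ : ∃ u, (σ u : ℕ) = i :=
      ⟨σ.symm ⟨i, lt_of_lt_of_le (Nat.lt_succ_self i) (hiv.trans (σ v).2.le)⟩, by simp⟩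
    have hex : ∀ u', (σ u' : ℕ) < i + 1 → u' ≠ u → (σ u' : ℕ) < i := fun u' hu' hne =>
      lt_of_le_of_ne (Nat.lt_succ_iff.1 hu')
        fun he => hne (σ.injective (Fin.ext (he.trans hu.symm)))
    by_cases huw : G.Adj u w
    · have huv := hsub u (by omega) huw
      rw [ldfsLabel_succ_of_adj hu (by omega) huw, ldfsLabel_succ_of_adj hu (by omega) huv]
      refine ⟨ih1.lt_or_eq.elim (fun hlt => (List.cons_lt_cons_iff.2 (Or.inr ⟨rfl, hlt⟩)).le)
        fun heq => by rw [heq], ?_⟩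
      rintro ⟨u', hu', h1, h2⟩
      refine List.cons_lt_cons_iff.2 (Or.inr ⟨rfl, ih2 ⟨u', hex u' hu' ?_, h1, h2⟩⟩)
      rintro rfl
      exact h2 huw
    · rw [ldfsLabel_succ_of_not_adj hu huw]
      by_cases huv : G.Adj u v
      · rw [ldfsLabel_succ_of_adj hu (by omega) huv]
        exact ⟨(ldfsLabel_lt_cons i w _).le, fun _ => ldfsLabel_lt_cons i w _⟩
      · rw [ldfsLabel_succ_of_not_adj hu huv]
        refine ⟨ih1, ?_⟩
        rintro ⟨u', hu', h1, h2⟩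
        refine ih2 ⟨u', hex u' hu' ?_, h1, h2⟩
        rintro rfl
        exact huv h1

theorem IsLDFSOrder.start_eq_zero (h : IsLDFSOrder G s σ) : (σ s : ℕ) = 0 := by
  have hcard : 0 < Fintype.card V := Fintype.card_pos_iff.2 ⟨s⟩
  have h0 : (σ (σ.symm ⟨0, hcard⟩) : ℕ) = 0 := by simp
  have hle := h (σ.symm ⟨0, hcard⟩) s (by rw [Fin.le_def, h0]; exact Nat.zero_le _)
  rw [h0] at hle
  by_contra hs
  have hne : σ.symm ⟨0, hcard⟩ ≠ s := fun he => hs (he ▸ h0)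
  simp only [ldfsLabel, if_true, if_neg hne] at hle
  exact absurd hle (not_le.2 (List.nil_lt_cons _ _))

theorem IsLDFSOrder.isMNSOrder (h : IsLDFSOrder G s σ) : IsMNSOrder G σ := by
  intro v w hvw hsub u hu huw
  by_contra huv
  have hs := h.start_eq_zero
  rw [Fin.lt_def] at hu
  rw [Fin.le_def] at hvw
  refine absurd (h v w hvw) (not_le.2 ?_)
  exact (ldfsLabel_mono (by rintro rfl; omega) (by rintro rfl; omega) _ hvw le_rfl hsub).2
    ⟨u, hu, huw, huv⟩

/-- When a vertex is picked, its numbered neighbours include those of every vertex that is not yet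
numbered. -/
def IsGreatestNbhdOrder (G : SimpleGraph V) (σ : V ≃ Fin (Fintype.card V)) : Prop :=
  ∀ v w u : V, σ v ≤ σ w → σ u < σ v → G.Adj u w → G.Adj u v

theorem IsGreatestNbhdOrder.isMCSOrder (h : IsGreatestNbhdOrder G σ) (hs : (σ s : ℕ) = 0) :
    IsMCSOrder G s σ :=
  ⟨hs, fun v w _ hvw => Set.ncard_le_ncard (fun u hu => ⟨hu.1, h v w u hvw hu.1 hu.2⟩)
    (Set.toFinite _)⟩

theorem IsGreatestNbhdOrder.isLDFSOrder (h : IsGreatestNbhdOrder G σ) (hs : (σ s : ℕ) = 0) :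
    IsLDFSOrder G s σ := by
  intro v w hvw
  by_cases hv : v = s
  · subst hv
    rw [hs]
    simp only [ldfsLabel, if_true]
    split_ifs
    · exact le_rfl
    · exact (List.nil_lt_cons _ _).le
  · have hw : w ≠ s := by
      rintro rfl
      rw [Fin.le_def, hs] at hvw
      exact hv (σ.injective (Fin.ext (by omega)))
    exact (ldfsLabel_mono hv hw _ le_rfl hvw fun u hu => h v w u hvw hu).1

end Searches

/-! ### Sorted orders ending in an extreme vertex. -/

theorem exists_sorted_equiv {V : Type*} [Fintype V] (f : V → ℝ) :
    ∃ σ : V ≃ Fin (Fintype.card V), ∀ v w, f v < f w → σ v < σ w := by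
  let e := Fintype.equivFin V
  let τ := Tuple.sort (f ∘ e.symm)
  refine ⟨e.trans τ.symm, fun v w hvw => ?_⟩
  by_contra hcon
  have := Tuple.monotone_sort (f ∘ e.symm) (not_lt.1 hcon)
  simp only [Function.comp_apply, Equiv.trans_apply, τ, Equiv.apply_symm_apply,
    Equiv.symm_apply_apply] at this
  exact absurd hvw (not_lt.2 this)

namespace IsIndifferenceRep

variable {V : Type*} {G : SimpleGraph V} {a : V → ℝ} {ℓ : ℝ} {t : V}

-- For a right end `t`, the other vertices within `ℓ` of `t` are exactly those within `ℓ` of the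
-- rightmost vertex `z`, so `t` may be placed at `a z`.
open Classical in
theorem update_max [Finite V] (h : IsIndifferenceRep G a ℓ) (ht : IsRightEnd a ℓ t) :
    ∃ b : V → ℝ, IsIndifferenceRep G b ℓ ∧ ∀ v, b v ≤ b t := by
  have hl := h.1
  have : Nonempty V := ⟨t⟩
  obtain ⟨z, hz⟩ := Finite.exists_max a
  have htz := ht t z (by linarith) (by linarith)
  refine ⟨Function.update a t (a z), ⟨hl, ?_⟩, fun v => ?_⟩
  · have key : ∀ v, v ≠ t → (G.Adj t v ↔ a v ≤ a z + ℓ ∧ a z ≤ a v + ℓ) := by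
      intro v hv
      rw [h.2]
      have h1 := hz v
      have h2 := hz t
      constructor
      · rintro ⟨-, h3, h4⟩
        exact ⟨by linarith, ht v z h4 h3⟩
      · rintro ⟨-, h3⟩
        exact ⟨hv.symm, by linarith, by linarith⟩
    intro u v
    by_cases hu : u = t
    · by_cases hv : v = t
      · simp [hu, hv]
      · rw [hu, key v hv, Function.update_self, Function.update_of_ne hv]
        exact ⟨fun hk => ⟨Ne.symm hv, hk.2, hk.1⟩, fun hk => ⟨hk.2.2, hk.2.1⟩⟩
    · by_cases hv : v = t
      · rw [hv, G.adj_comm, key u hu, Function.update_self, Function.update_of_ne hu]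
        exact ⟨fun hk => ⟨hu, hk⟩, fun hk => hk.2⟩
      · rw [h.2, Function.update_of_ne hu, Function.update_of_ne hv]
  · rw [Function.update_self]
    by_cases hv : v = t
    · rw [hv, Function.update_self]
    · rw [Function.update_of_ne hv]
      exact hz v

-- From left to right, an earlier neighbour of `w` is also within `ℓ` of every `v` placed between
-- the two.
open Classical in
theorem exists_greatestNbhdOrder_of_isMax [Fintype V] (h : IsIndifferenceRep G a ℓ)
    (ht : ∀ v, a v ≤ a t) :
    ∃ σ : V ≃ Fin (Fintype.card V), IsGreatestNbhdOrder G σ ∧ ∀ v, σ v ≤ σ t := by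
  have hl := h.1
  -- Raising the key of `t` by `1` puts `t` last among all vertices tied with it.
  obtain ⟨σ, hσ⟩ := exists_sorted_equiv (Function.update a t (a t + 1))
  have hlast : ∀ v, σ v ≤ σ t := by
    intro v
    by_cases hv : v = t
    · rw [hv]
    · refine (hσ v t ?_).le
      rw [Function.update_self, Function.update_of_ne hv]
      linarith [ht v]
  have hmono : ∀ v w, σ v ≤ σ w → a v ≤ a w := by
    intro v w hvw
    by_contra hcon
    by_cases hv : v = t
    · rw [hv] at hvw hcon
      rw [σ.injective (le_antisymm hvw (hlast w))] at hcon
      exact hcon le_rfl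
    by_cases hw : w = t
    · rw [hw] at hcon
      exact hcon (ht v)
    · refine absurd (hσ w v ?_) (not_lt.2 hvw)
      rw [Function.update_of_ne hv, Function.update_of_ne hw]
      exact not_le.1 hcon
  refine ⟨σ, fun v w u hvw huv huw => (h.2 _ _).2 ⟨?_, ?_, ?_⟩, hlast⟩
  · rintro rfl
    exact lt_irrefl _ huv
  · linarith [hmono u v huv.le]
  · linarith [hmono v w hvw, ((h.2 _ _).1 huw).2.2]

theorem exists_greatestNbhdOrder [Fintype V] (h : IsIndifferenceRep G a ℓ)
    (ht : IsRightEnd a ℓ t ∨ IsRightEnd (fun v => - a v) ℓ t) :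
    ∃ σ : V ≃ Fin (Fintype.card V), IsGreatestNbhdOrder G σ ∧ ∀ v, σ v ≤ σ t := by
  rcases ht with ht | ht
  · obtain ⟨b, hb, hmax⟩ := h.update_max ht
    exact hb.exists_greatestNbhdOrder_of_isMax hmax
  · obtain ⟨b, hb, hmax⟩ := h.neg.update_max ht
    exact hb.exists_greatestNbhdOrder_of_isMax hmax

end IsIndifferenceRep

theorem isEndVertexOf_iff {V : Type*} [Fintype V] {σ : V ≃ Fin (Fintype.card V)} {t : V} :
    IsEndVertexOf σ t ↔ ∀ v, σ v ≤ σ t := by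
  unfold IsEndVertexOf
  constructor
  · intro h v
    rw [Fin.le_def]
    have := (σ v).2
    omega
  · intro h
    have hc := (σ t).2
    have := h (σ.symm ⟨Fintype.card V - 1, by omega⟩)
    rw [Equiv.apply_symm_apply, Fin.le_def] at this
    dsimp only at this
    omega

/-! ### The end-vertices of both searches. -/

section EndVertices

variable {V : Type*} [Fintype V] {G : SimpleGraph V} {t : V}

theorem IsUnitIntervalGraph.simplicialWithConnectedRest_of_mns (hK : IsUnitIntervalGraph G)
    (hG : G.Preconnected) {σ : V ≃ Fin (Fintype.card V)} (hσ : IsMNSOrder G σ)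
    (ht : IsEndVertexOf σ t) : IsSimplicialWithConnectedRest G t := by
  obtain ⟨a, ℓ, h⟩ := hK.exists_indifferenceRep
  exact (h.simplicialWithConnectedRest_iff hG).2
    (h.isRightEnd_or_of_mns hG hσ (isEndVertexOf_iff.1 ht))

theorem IsUnitIntervalGraph.exists_greatestNbhdOrder (hK : IsUnitIntervalGraph G)
    (hG : G.Preconnected) (ht : IsSimplicialWithConnectedRest G t) :
    ∃ (s : V) (σ : V ≃ Fin (Fintype.card V)), (σ s : ℕ) = 0 ∧ IsGreatestNbhdOrder G σ ∧
      IsEndVertexOf σ t := by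
  obtain ⟨a, ℓ, h⟩ := hK.exists_indifferenceRep
  obtain ⟨σ, hσ, hlast⟩ :=
    h.exists_greatestNbhdOrder ((h.simplicialWithConnectedRest_iff hG).1 ht)
  exact ⟨σ.symm ⟨0, Fintype.card_pos_iff.2 ⟨t⟩⟩, σ, by simp, hσ, isEndVertexOf_iff.2 hlast⟩

theorem IsUnitIntervalGraph.isMCSEndVertex_iff (hK : IsUnitIntervalGraph G)
    (hG : G.Preconnected) : IsMCSEndVertex G t ↔ IsSimplicialWithConnectedRest G t := by
  constructor
  · rintro ⟨s, σ, hσ, ht⟩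
    exact hK.simplicialWithConnectedRest_of_mns hG hσ.isMNSOrder ht
  · intro ht
    obtain ⟨s, σ, hs, hσ, he⟩ := hK.exists_greatestNbhdOrder hG ht
    exact ⟨s, σ, hσ.isMCSOrder hs, he⟩

theorem IsUnitIntervalGraph.isLDFSEndVertex_iff (hK : IsUnitIntervalGraph G)
    (hG : G.Preconnected) : IsLDFSEndVertex G t ↔ IsSimplicialWithConnectedRest G t := by
  constructor
  · rintro ⟨s, σ, hσ, ht⟩
    exact hK.simplicialWithConnectedRest_of_mns hG hσ.isMNSOrder ht
  · intro ht
    obtain ⟨s, σ, hs, hσ, he⟩ := hK.exists_greatestNbhdOrder hG ht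
    exact ⟨s, σ, hσ.isLDFSOrder hs, he⟩

end EndVertices

/-! ## Reasoning about programs -/

/-- The program `P` halts after at most `N` steps in a state that satisfies `Q`. -/
def RamRuns (W : ℕ) (P : RamProgram) (S : RamState) (N : ℕ) (Q : RamState → Prop) : Prop :=
  ∃ T S', RamExec W P S T S' ∧ T ≤ N ∧ Q S'

namespace RamState

theorem setReg_reg (S : RamState) (d x r : ℕ) :
    (S.setReg d x).reg r = if r = d then x else S.reg r := by
  simp [setReg, Function.update_apply]

theorem setReg_mem (S : RamState) (d x : ℕ) : (S.setReg d x).mem = S.mem := rfl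

theorem setMem_reg (S : RamState) (p x : ℕ) : (S.setMem p x).reg = S.reg := rfl

theorem setMem_mem (S : RamState) (p x : ℕ) :
    (S.setMem p x).mem = Function.update S.mem p x := rfl

end RamState

namespace RamRuns

variable {W N N' : ℕ} {P P' : RamProgram} {S : RamState} {Q R : RamState → Prop}

theorem mono (h : RamRuns W P S N Q) (hN : N ≤ N') (hQ : ∀ S', Q S' → R S') :
    RamRuns W P S N' R := by
  obtain ⟨T, S', hT, hle, hq⟩ := h
  exact ⟨T, S', hT, hle.trans hN, hQ S' hq⟩

theorem skip (h : Q S) : RamRuns W .skip S 0 Q := ⟨0, S, .skip S, le_rfl, h⟩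

theorem instr {I : RamInstr} (hv : I.value S ≤ W) (h : Q (I.apply S)) :
    RamRuns W (.instr I) S 1 Q := ⟨1, _, .instr I S hv, le_rfl, h⟩

theorem seq (h : RamRuns W P S N Q) (h' : ∀ S', Q S' → RamRuns W P' S' N' R) :
    RamRuns W (.seq P P') S (N + N') R := by
  obtain ⟨T, S', hT, hle, hq⟩ := h
  obtain ⟨T', S'', hT', hle', hr⟩ := h' S' hq
  exact ⟨T + T', S'', .seq hT hT', Nat.add_le_add hle hle', hr⟩

theorem instr_seq {I : RamInstr} (hv : I.value S ≤ W) (h : RamRuns W P (I.apply S) N Q) :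
    RamRuns W (.seq (.instr I) P) S (1 + N) Q :=
  (instr (Q := fun S' => S' = I.apply S) hv rfl).seq fun _ hS' => hS' ▸ h

theorem ite {b : RamTest} (ht : b.Holds S → RamRuns W P S N Q)
    (hf : ¬ b.Holds S → RamRuns W P' S N Q) : RamRuns W (.ite b P P') S (N + 1) Q := by
  by_cases hb : b.Holds S
  · obtain ⟨T, S', hT, hle, hq⟩ := ht hb
    exact ⟨T + 1, S', .ite_true hb hT, Nat.succ_le_succ hle, hq⟩
  · obtain ⟨T, S', hT, hle, hq⟩ := hf hb
    exact ⟨T + 1, S', .ite_false hb hT, Nat.succ_le_succ hle, hq⟩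

theorem while_done {b : RamTest} (hb : ¬ b.Holds S) (h : Q S) : RamRuns W (.while b P) S 1 Q :=
  ⟨1, S, .while_false hb, le_rfl, h⟩

theorem while_step {b : RamTest} (hb : b.Holds S) (h : RamRuns W P S N R)
    (h' : ∀ S', R S' → RamRuns W (.while b P) S' N' Q) :
    RamRuns W (.while b P) S (N + N' + 1) Q := by
  obtain ⟨T, S', hT, hle, hq⟩ := h
  obtain ⟨T', S'', hT', hle', hr⟩ := h' S' hq
  exact ⟨T + T' + 1, S'', .while_true hb hT hT', by omega, hr⟩

end RamRuns

/-! ## The memory layout of a graph -/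

section Layout

variable {n : ℕ} (adj : Fin n → List (Fin n)) (t : Fin n)

/-- The address of the first entry of the adjacency list of `k`. -/
def adjOffset (k : ℕ) : ℕ := n + 3 + ((List.ofFn fun v => (adj v).length).take k).sum

theorem adjOffset_succ (v : Fin n) :
    adjOffset adj (v + 1) = adjOffset adj v + (adj v).length := by
  unfold adjOffset
  rw [List.take_add_one, List.getElem?_eq_getElem (by simp), List.sum_append]
  simp [add_assoc]

theorem adjOffset_mono {k l : ℕ} (h : k ≤ l) : adjOffset adj k ≤ adjOffset adj l := by
  unfold adjOffset
  obtain ⟨m, rfl⟩ := Nat.exists_eq_add_of_le h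
  rw [List.take_add, List.sum_append]
  omega

theorem adjOffset_add_length_le (v : Fin n) :
    adjOffset adj v + (adj v).length ≤ adjOffset adj n := by
  rw [← adjOffset_succ]
  exact adjOffset_mono adj v.2

theorem adjOffset_last : adjOffset adj n = n + 3 + ∑ v, (adj v).length := by
  unfold adjOffset
  rw [List.take_of_length_le (by simp), List.sum_ofFn]

theorem graphInput_length : (graphInput adj t).length = adjOffset adj n := by
  rw [adjOffset_last]
  simp only [graphInput, List.length_append, List.length_map, List.length_range, List.length_cons,
    List.length_nil, List.length_flatten, List.map_ofFn, List.sum_ofFn, Function.comp_apply]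
  omega

theorem graphInput_getD_zero : (graphInput adj t).getD 0 0 = n := by
  simp [graphInput]

theorem graphInput_getD_one : (graphInput adj t).getD 1 0 = t := by
  simp [graphInput]

theorem graphInput_getD_offset {k : ℕ} (hk : k ≤ n) :
    (graphInput adj t).getD (k + 2) 0 = adjOffset adj k := by
  unfold graphInput
  rw [List.getD_append _ _ _ _ (by simp; omega), List.getD_append_right _ _ _ _ (by simp)]
  simp [adjOffset, Nat.lt_succ_of_le hk]

theorem graphInput_getD_adj (v : Fin n) {j : ℕ} (hj : j < (adj v).length) :
    (graphInput adj t).getD (adjOffset adj v + j) 0 = (adj v)[j] := by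
  -- The list of `v` is the segment of the flattened list between two consecutive prefix sums of
  -- lengths.
  have hdrop := List.drop_take_succ_flatten_eq_getElem (List.ofFn adj) v (by simp)
  have hmap : (List.ofFn adj).map List.length = List.ofFn fun v => (adj v).length := by
    rw [List.map_ofFn]; rfl
  rw [hmap] at hdrop
  have hget : (List.ofFn adj).flatten[((List.ofFn fun v => (adj v).length).take v).sum + j]?
      = some ((adj v)[j]) := by
    have h2 : (adj v)[j]? = some ((adj v)[j]) := List.getElem?_eq_getElem hj
    have h3 : (List.ofFn adj)[(v : ℕ)]'(by simp) = adj v := by simp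
    rw [h3] at hdrop
    replace h2 := (congrArg (fun l => l[j]?) hdrop).trans h2
    simp only [List.getElem?_drop, List.getElem?_take] at h2
    split_ifs at h2 with hlt
    · rw [h2]
  unfold graphInput adjOffset
  rw [List.getD_append_right _ _ _ _ (by simp; omega), List.getD_eq_getElem?_getD]
  have hidx : n + 3 + ((List.ofFn fun v => (adj v).length).take v).sum + j -
      ([n, (t : ℕ)] ++ (List.range (n + 1)).map
        (fun k => n + 3 + ((List.ofFn fun v => (adj v).length).take k).sum)).length =
      ((List.ofFn fun v => (adj v).length).take v).sum + j := by
    simp; omega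
  rw [hidx, List.getElem?_map, hget]
  rfl

/-- The memory that holds the input graph, followed by an array in which the vertices of `M` are
marked. -/
def markedMemory (M : Finset (Fin n)) (i : ℕ) : ℕ :=
  if i < adjOffset adj n then (graphInput adj t).getD i 0
  else if ∃ v ∈ M, adjOffset adj n + (v : ℕ) = i then 1 else 0

/-- The mark of `v` sits `v` cells behind the end of the input, where memory is initially `0`. -/
theorem initialState_mem : (initialState (graphInput adj t)).mem = markedMemory adj t ∅ := by
  funext i
  simp only [initialState, markedMemory]
  split_ifs with h1 h2
  · rfl
  · simp at h2
  · rw [List.getD_eq_default]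
    rw [graphInput_length]
    omega

variable {adj t}

theorem markedMemory_one (M : Finset (Fin n)) : markedMemory adj t M 1 = t := by
  have := adjOffset_last adj
  rw [markedMemory, if_pos (by omega), graphInput_getD_one]

theorem markedMemory_zero (M : Finset (Fin n)) : markedMemory adj t M 0 = n := by
  have := adjOffset_last adj
  rw [markedMemory, if_pos (by omega), graphInput_getD_zero]

theorem markedMemory_offset (M : Finset (Fin n)) {k : ℕ} (hk : k ≤ n) :
    markedMemory adj t M (k + 2) = adjOffset adj k := by
  have := adjOffset_last adj
  rw [markedMemory, if_pos (by omega), graphInput_getD_offset adj t hk]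

theorem markedMemory_adj (M : Finset (Fin n)) {u v : Fin n} {pre post : List (Fin n)}
    (h : adj u = pre ++ v :: post) : markedMemory adj t M (adjOffset adj u + pre.length) = v := by
  have hlen : pre.length < (adj u).length := by rw [h]; simp
  have := adjOffset_add_length_le adj u
  rw [markedMemory, if_pos (by omega), graphInput_getD_adj adj t u hlen]
  simp [h]

theorem markedMemory_mark (M : Finset (Fin n)) (v : Fin n) :
    markedMemory adj t M (adjOffset adj n + v) = if v ∈ M then 1 else 0 := by
  rw [markedMemory, if_neg (by omega)]
  congr 1
  simp only [Nat.add_left_cancel_iff, eq_iff_iff]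
  exact ⟨fun ⟨w, hw, h⟩ => Fin.ext h ▸ hw, fun h => ⟨v, h, rfl⟩⟩

theorem markedMemory_update (M : Finset (Fin n)) (v : Fin n) :
    Function.update (markedMemory adj t M) (adjOffset adj n + v) 1 =
      markedMemory adj t (insert v M) := by
  funext i
  rw [Function.update_apply]
  by_cases hi : i = adjOffset adj n + v
  · rw [if_pos hi, hi, markedMemory_mark, if_pos (Finset.mem_insert_self _ _)]
  · rw [if_neg hi, markedMemory, markedMemory]
    simp only [Finset.exists_mem_insert, Ne.symm hi, false_or]

end Layout

/-! ## Running through an adjacency list -/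

/-- For every entry `w` of the adjacency list of the vertex in register `x`, run `body` with `w` in
register `w`. The registers `i` and `e` hold the current address and the end of the list. -/
def adjLoop (x i e w : ℕ) (body : RamProgram) : RamProgram :=
  .seq (.instr (.add e x 2)) <| .seq (.instr (.load i e)) <| .seq (.instr (.add e e 1)) <|
  .seq (.instr (.load e e)) <|
  .while (.lt i e) <| .seq (.instr (.load w i)) <| .seq (.instr (.add i i 1)) body

/-- `Inv pre` describes the state once the entries `pre` are processed; by `hstable` it ignores the
registers `i`, `e` and `w`. An entry costs `c v` plus a test, a load and an increment. The final `5`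
is four set-up instructions and the failing test. -/
theorem ramRuns_adjLoop {W n : ℕ} {adj : Fin n → List (Fin n)} {t : Fin n}
    (hW : adjOffset adj n + n ≤ W) {x i e w : ℕ} {body : RamProgram} (hie : i ≠ e) (hwi : w ≠ i)
    (hwe : w ≠ e) (hi : 1 ≠ i) (he : 1 ≠ e) (hw : 1 ≠ w) {u : Fin n}
    (Inv : List (Fin n) → RamState → Prop) (c : Fin n → ℕ)
    (hInv : ∀ pre S, Inv pre S → S.reg 1 = 1 ∧ ∃ M, S.mem = markedMemory adj t M)
    (hstable : ∀ pre S S', Inv pre S → S'.mem = S.mem →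
      (∀ r, r ≠ i → r ≠ e → r ≠ w → S'.reg r = S.reg r) → Inv pre S')
    (hbody : ∀ (pre : List (Fin n)) (v : Fin n) (post : List (Fin n)), adj u = pre ++ v :: post → ∀ S, Inv pre S → S.reg w = v →
      RamRuns W body S (c v)
        (fun S' => S'.reg i = S.reg i ∧ S'.reg e = S.reg e ∧ Inv (pre ++ [v]) S'))
    {S : RamState} (hS : Inv [] S) (hx : S.reg x = u) (h2 : S.reg 2 = 2) :
    RamRuns W (adjLoop x i e w body) S (((adj u).map fun v => c v + 3).sum + 5)
      (Inv (adj u)) := by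
  have hlast := adjOffset_last adj
  have hle := adjOffset_add_length_le adj u
  have hloop : ∀ post pre, adj u = pre ++ post → ∀ S, Inv pre S →
      S.reg i = adjOffset adj u + pre.length → S.reg e = adjOffset adj u + (adj u).length →
      RamRuns W (.while (.lt i e) <| .seq (.instr (.load w i)) <| .seq (.instr (.add i i 1)) body) S
        ((post.map fun v => c v + 3).sum + 1) (Inv (adj u)) := by
    intro post
    induction post with
    | nil =>
      intro pre hpre S hS hSi hSe
      rw [List.append_nil] at hpre
      refine RamRuns.while_done ?_ (hpre ▸ hS)
      simp only [RamTest.Holds, hSi, hSe, hpre, lt_irrefl, not_false_iff]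
    | cons v post ih =>
      intro pre hpre S hS hSi hSe
      obtain ⟨h1, M, hM⟩ := hInv pre S hS
      have hlen : pre.length < (adj u).length := by rw [hpre]; simp
      have hv : S.mem (S.reg i) = v := by rw [hM, hSi, markedMemory_adj M hpre]
      refine (RamRuns.while_step (N := 2 + c v) (N' := (post.map fun v => c v + 3).sum + 1)
        (R := fun S' => S'.reg i = S.reg i + 1 ∧ S'.reg e = S.reg e ∧ Inv (pre ++ [v]) S')
        (by simp only [RamTest.Holds, hSi, hSe]; omega) ?_ ?_).mono ?_ (fun _ h => h)
      · rw [show 2 + c v = 1 + (1 + c v) by omega]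
        refine RamRuns.instr_seq ?_ (RamRuns.instr_seq ?_ ?_)
        · simp only [RamInstr.value, hv]; omega
        · simp only [RamInstr.value, RamInstr.apply, RamState.setReg_reg, if_neg hwi.symm, if_neg hw,
            hSi, h1]
          omega
        · refine (hbody pre v post hpre _ (hstable pre S _ hS ?_ ?_) ?_).mono le_rfl ?_
          · simp only [RamInstr.apply, RamState.setReg_mem]
          · intro r hri hre hrw
            simp only [RamInstr.apply, RamState.setReg_reg, if_neg hri, if_neg hrw]
          · simp only [RamInstr.apply, RamInstr.value, RamState.setReg_reg, if_neg hwi, if_true, hv]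
          · rintro S' ⟨h3, h4, h5⟩
            simp only [RamInstr.apply, RamInstr.value, RamState.setReg_reg, if_neg hwi.symm,
              if_neg hw, if_true, if_neg hie.symm, if_neg hwe.symm, h1] at h3 h4
            exact ⟨h3, h4, h5⟩
      · rintro S' ⟨h3, h4, h5⟩
        refine ih (pre ++ [v]) (by simp [hpre]) S' h5 ?_ (h4.trans hSe)
        rw [h3, hSi, List.length_append]
        rfl
      · simp only [List.map_cons, List.sum_cons]
        omega
  obtain ⟨h1, M, hM⟩ := hInv [] S hS
  -- The offset table starts at cell `2`, so cells `u + 2` and `u + 3` delimit the list of `u`.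
  have hp : S.mem ((u : ℕ) + 2) = adjOffset adj u := by rw [hM, markedMemory_offset M u.2.le]
  have hq : S.mem ((u : ℕ) + 2 + 1) = adjOffset adj u + (adj u).length := by
    rw [hM, ← adjOffset_succ, ← markedMemory_offset (t := t) M u.2, add_right_comm]
  rw [show ((adj u).map fun v => c v + 3).sum + 5 =
    1 + (1 + (1 + (1 + (((adj u).map fun v => c v + 3).sum + 1)))) by omega]
  have hu := u.2
  refine RamRuns.instr_seq ?_ <| RamRuns.instr_seq ?_ <| RamRuns.instr_seq ?_ <|
    RamRuns.instr_seq ?_ (hloop (adj u) [] rfl _ (hstable [] S _ hS ?_ ?_) ?_ ?_)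
  · simp only [RamInstr.value, hx, h2]; omega
  · simp only [RamInstr.value, RamInstr.apply, RamState.setReg_reg, RamState.setReg_mem, if_true,
      hx, h2, hp]
    omega
  · simp only [RamInstr.value, RamInstr.apply, RamState.setReg_reg, RamState.setReg_mem, if_true,
      hx, h2, if_neg he, if_neg hi, if_neg hie.symm, h1]
    omega
  · simp only [RamInstr.value, RamInstr.apply, RamState.setReg_reg, RamState.setReg_mem, if_true,
      hx, h2, if_neg he, if_neg hi, if_neg hie.symm, h1, hq]
    omega
  · simp only [RamInstr.apply, RamState.setReg_mem]
  · intro r hri hre hrw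
    simp only [RamInstr.apply, RamState.setReg_reg, if_neg hri, if_neg hre]
  · simp only [RamInstr.value, RamInstr.apply, RamState.setReg_reg, RamState.setReg_mem, if_true,
      hx, h2, if_neg hie, hp, List.length_nil, add_zero]
  · simp only [RamInstr.value, RamInstr.apply, RamState.setReg_reg, RamState.setReg_mem, if_true,
      hx, h2, if_neg he, if_neg hi, if_neg hie.symm, h1, hq]

/-! ## The program -/

/-- Mark the neighbours of the vertex in register `x` and count them in register `15`. -/
def markLoop (x : ℕ) : RamProgram :=
  .seq (.instr (.const 15 0)) <| adjLoop x 9 10 11 <|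
    .seq (.instr (.add 12 3 11)) <| .seq (.instr (.store 12 1)) (.instr (.add 15 15 1))

/-- Count the marked neighbours of the vertex in register `8` in register `14`, and all its
neighbours in register `15`. -/
def countLoop : RamProgram :=
  .seq (.instr (.const 14 0)) <| .seq (.instr (.const 15 0)) <| adjLoop 8 9 10 11 <|
    .seq (.instr (.add 12 3 11)) <| .seq (.instr (.load 13 12)) <|
    .seq (.instr (.add 14 14 13)) (.instr (.add 15 15 1))

/-- Write `0` into register `0` if some neighbour of the vertex in register `4` has a number of
marked neighbours other than the content of register `5`. Update the vertex in register `16` and its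
degree in register `17` whenever a neighbour has a larger degree. -/
def cliqueLoop : RamProgram :=
  adjLoop 4 6 7 8 <| .seq countLoop <|
    .seq (.ite (.eq 14 5) .skip (.instr (.const 0 0)))
      (.ite (.lt 17 15) (.seq (.instr (.move 17 15)) (.instr (.move 16 8))) .skip)

/-- Write `0` into register `0` if some neighbour of the vertex in register `4` has an unmarked
neighbour. -/
def coverLoop : RamProgram :=
  adjLoop 4 6 7 8 <| .seq countLoop (.ite (.eq 14 15) .skip (.instr (.const 0 0)))

/-- Load the constants `1` and `2`, the end of the input and the vertex `t` into the registers
`1`, `2`, `3` and `4`, the provisional answer `1` into register `0`, and mark `t`. -/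
def initProgram : RamProgram :=
  .seq (.instr (.const 1 1)) <| .seq (.instr (.const 2 2)) <| .seq (.instr (.load 5 0)) <|
  .seq (.instr (.add 5 5 2)) <| .seq (.instr (.load 3 5)) <| .seq (.instr (.load 4 1)) <|
  .seq (.instr (.const 0 1)) <| .seq (.instr (.add 12 3 4)) (.instr (.store 12 1))

/-- Decide whether the closed neighbourhood of the given vertex is a clique whose vertices have all
their neighbours in this clique or among the neighbours of its vertex of maximum degree. -/
def endVertexProgram : RamProgram :=
  .seq initProgram <| .seq (markLoop 4) <|
  .seq (.instr (.move 5 15)) <| .seq (.instr (.move 17 15)) <| .seq (.instr (.move 16 4)) <|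
  .seq cliqueLoop <| .seq (markLoop 16) coverLoop

/-- The registers `1`, …, `4` hold the constants `1` and `2`, the end of the input and the vertex
`t`, and the memory holds the input and the marks of the vertices of `M`. -/
structure IsGraphState {n : ℕ} (adj : Fin n → List (Fin n)) (t : Fin n) (M : Finset (Fin n))
    (S : RamState) : Prop where
  mem : S.mem = markedMemory adj t M
  one : S.reg 1 = 1
  two : S.reg 2 = 2
  base : S.reg 3 = adjOffset adj n
  target : S.reg 4 = t

/-- Register `0` holds the truth value of `A`. -/
def RamState.Answers (S : RamState) (A : Prop) : Prop :=
  (A → S.reg 0 = 1) ∧ (¬ A → S.reg 0 = 0)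

/-! ### Effect and cost of each program piece. -/

section Specifications

variable {n : ℕ} {adj : Fin n → List (Fin n)} {t : Fin n} {M : Finset (Fin n)} {S : RamState}
  {W : ℕ}

theorem IsGraphState.of_reg_eq {M' : Finset (Fin n)} {S' : RamState} (h : IsGraphState adj t M S)
    (hm : S'.mem = markedMemory adj t M') (hr : ∀ r, 1 ≤ r → r ≤ 4 → S'.reg r = S.reg r) :
    IsGraphState adj t M' S' :=
  ⟨hm, (hr 1 (by omega) (by omega)).trans h.one, (hr 2 (by omega) (by omega)).trans h.two,
    (hr 3 (by omega) (by omega)).trans h.base, (hr 4 (by omega) (by omega)).trans h.target⟩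

/-- Registers `9` to `15` are scratch space for the inner loops; preserving the others keeps the
outer loop registers `6`, `7`, `8` and the results in `0`, `5`, `16`, `17`. -/
theorem ramRuns_markLoop (hW : adjOffset adj n + n ≤ W) (hS : IsGraphState adj t M S) {x : ℕ}
    (hx : x < 9 ∨ 15 < x) {u : Fin n} (hu : S.reg x = u) :
    RamRuns W (markLoop x) S (6 * (adj u).length + 6) (fun S' =>
      S'.mem = markedMemory adj t (M ∪ (adj u).toFinset) ∧ S'.reg 15 = (adj u).length ∧
        ∀ r, r < 9 ∨ 15 < r → S'.reg r = S.reg r) := by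
  have hle := adjOffset_add_length_le adj u
  have hlast := adjOffset_last adj
  refine RamRuns.mono (N := 1 + (((adj u).map fun _ => 3 + 3).sum + 5))
    (RamRuns.instr_seq (by simp [RamInstr.value]) ?_) (by simp; omega) (fun S' h => h)
  refine ramRuns_adjLoop (t := t) hW (by decide) (by decide) (by decide) (by decide) (by decide) (by decide)
    (fun pre S' => S'.mem = markedMemory adj t (M ∪ pre.toFinset) ∧ S'.reg 15 = pre.length ∧
        ∀ r, r < 9 ∨ 15 < r → S'.reg r = S.reg r) (fun _ => 3) ?_ ?_ ?_ ?_ ?_ ?_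
  · rintro pre S' ⟨hm, -, hr⟩
    exact ⟨(hr 1 (by omega)).trans hS.one, _, hm⟩
  · rintro pre S' S'' ⟨hm, h15, hr⟩ hm' hr'
    refine ⟨hm'.trans hm, (hr' 15 (by omega) (by omega) (by omega)).trans h15, fun r h => ?_⟩
    exact (hr' r (by omega) (by omega) (by omega)).trans (hr r h)
  · rintro pre v post hpre S' ⟨hm, h15, hr⟩ hv
    have h1 := (hr 1 (by omega)).trans hS.one
    have h3 := (hr 3 (by omega)).trans hS.base
    have hlen : pre.length < (adj u).length := by rw [hpre]; simp
    have hvn := v.2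
    refine RamRuns.instr_seq (N := 1 + 1) ?_ <| RamRuns.instr_seq ?_ <| RamRuns.instr ?_ ?_
    · simp only [RamInstr.value, h3, hv]; omega
    · simp [RamInstr.value, RamInstr.apply, RamState.setReg_reg, h1]; omega
    · simp [RamInstr.value, RamInstr.apply, RamState.setReg_reg, RamState.setMem_reg, h1, h15]
      omega
    · refine ⟨by simp [RamInstr.apply, RamState.setReg_reg, RamState.setMem_reg],
        by simp [RamInstr.apply, RamState.setReg_reg, RamState.setMem_reg], ?_, ?_, ?_⟩
      · simp only [RamInstr.value, RamInstr.apply, RamState.setReg_reg, RamState.setReg_mem,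
          RamState.setMem_mem, if_true, h3, hv, hm]
        rw [if_neg (by decide), h1, markedMemory_update]
        congr 1
        ext z
        simp
      · simp [RamInstr.value, RamInstr.apply, RamState.setReg_reg, RamState.setMem_reg, h1, h15]
      · intro r h
        simp only [RamInstr.apply, RamState.setReg_reg, RamState.setMem_reg]
        rw [if_neg (by omega), if_neg (by omega), hr r h]
  · refine ⟨by simpa [RamInstr.apply, RamState.setReg_mem] using hS.mem,
      by simp [RamInstr.apply, RamInstr.value, RamState.setReg_reg], fun r h => ?_⟩
    simp only [RamInstr.apply, RamState.setReg_reg]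
    rw [if_neg (by omega)]
  · simp only [RamInstr.apply, RamState.setReg_reg]
    rw [if_neg (by omega), hu]
  · simp [RamInstr.apply, RamState.setReg_reg, hS.two]

theorem ramRuns_countLoop (hW : adjOffset adj n + n ≤ W) (hS : IsGraphState adj t M S)
    {u : Fin n} (hu : S.reg 8 = u) :
    RamRuns W countLoop S (7 * (adj u).length + 7) (fun S' =>
      S'.mem = markedMemory adj t M ∧ S'.reg 14 = (adj u).countP (· ∈ M) ∧
        S'.reg 15 = (adj u).length ∧ ∀ r, r < 9 ∨ 15 < r → S'.reg r = S.reg r) := by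
  have hle := adjOffset_add_length_le adj u
  have hlast := adjOffset_last adj
  refine RamRuns.mono (N := 1 + (1 + (((adj u).map fun _ => 4 + 3).sum + 5)))
    (RamRuns.instr_seq (by simp [RamInstr.value]) <|
      RamRuns.instr_seq (by simp [RamInstr.value]) ?_) (by simp; omega) (fun S' h => h)
  refine ramRuns_adjLoop (t := t) hW (by decide) (by decide) (by decide) (by decide) (by decide) (by decide)
    (fun pre S' => S'.mem = markedMemory adj t M ∧ S'.reg 14 = pre.countP (· ∈ M) ∧
      S'.reg 15 = pre.length ∧ ∀ r, r < 9 ∨ 15 < r → S'.reg r = S.reg r) (fun _ => 4)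
    ?_ ?_ ?_ ?_ ?_ ?_
  · rintro pre S' ⟨hm, -, -, hr⟩
    exact ⟨(hr 1 (by omega)).trans hS.one, _, hm⟩
  · rintro pre S' S'' ⟨hm, h14, h15, hr⟩ hm' hr'
    refine ⟨hm'.trans hm, (hr' 14 (by omega) (by omega) (by omega)).trans h14,
      (hr' 15 (by omega) (by omega) (by omega)).trans h15, fun r h => ?_⟩
    exact (hr' r (by omega) (by omega) (by omega)).trans (hr r h)
  · rintro pre v post hpre S' ⟨hm, h14, h15, hr⟩ hv
    have h1 := (hr 1 (by omega)).trans hS.one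
    have h3 := (hr 3 (by omega)).trans hS.base
    have hlen : pre.length < (adj u).length := by rw [hpre]; simp
    have hcount : pre.countP (· ∈ M) ≤ pre.length := List.countP_le_length
    have hvn := v.2
    have hmark : S'.mem (adjOffset adj n + v) = if v ∈ M then 1 else 0 := by
      rw [hm, markedMemory_mark]
    refine RamRuns.instr_seq (N := 1 + (1 + 1)) ?_ <| RamRuns.instr_seq ?_ <|
      RamRuns.instr_seq ?_ <| RamRuns.instr ?_ ?_
    · simp only [RamInstr.value, h3, hv]; omega
    · simp [RamInstr.value, RamInstr.apply, RamState.setReg_reg, RamState.setReg_mem, h3, hv, hmark]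
      split_ifs <;> omega
    · simp [RamInstr.value, RamInstr.apply, RamState.setReg_reg, RamState.setReg_mem, h3, hv, hmark,
        h14]
      split_ifs <;> omega
    · simp [RamInstr.value, RamInstr.apply, RamState.setReg_reg, h1, h15]
      omega
    · refine ⟨by simp [RamInstr.apply, RamState.setReg_reg],
        by simp [RamInstr.apply, RamState.setReg_reg], ?_, ?_, ?_, ?_⟩
      · simpa only [RamInstr.apply, RamState.setReg_mem] using hm
      · simp [RamInstr.value, RamInstr.apply, RamState.setReg_reg, RamState.setReg_mem, h3, hv,
          hmark, h14, List.countP_append, List.countP_cons]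
      · simp [RamInstr.value, RamInstr.apply, RamState.setReg_reg, h1, h15]
      · intro r h
        simp only [RamInstr.apply, RamState.setReg_reg]
        rw [if_neg (by omega), if_neg (by omega), if_neg (by omega), if_neg (by omega), hr r h]
  · refine ⟨by simpa [RamInstr.apply, RamState.setReg_mem] using hS.mem,
      by simp [RamInstr.apply, RamInstr.value, RamState.setReg_reg],
      by simp [RamInstr.apply, RamInstr.value, RamState.setReg_reg], fun r h => ?_⟩
    simp only [RamInstr.apply, RamState.setReg_reg]
    rw [if_neg (by omega), if_neg (by omega)]
  · simp [RamInstr.apply, RamState.setReg_reg, hu]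
  · simp [RamInstr.apply, RamState.setReg_reg, hS.two]

theorem RamState.Answers.and_of_ite {S S' : RamState} {A B : Prop} (h : S.Answers A)
    (hB : B → S'.reg 0 = S.reg 0) (hB' : ¬ B → S'.reg 0 = 0) : S'.Answers (A ∧ B) := by
  constructor
  · rintro ⟨hA, hb⟩
    exact (hB hb).trans (h.1 hA)
  · intro hAB
    by_cases hb : B
    · exact (hB hb).trans (h.2 fun hA => hAB ⟨hA, hb⟩)
    · exact hB' hb

theorem RamState.Answers.congr {S S' : RamState} {A B : Prop} (h : S.Answers A)
    (hr : S'.reg 0 = S.reg 0) (hAB : A ↔ B) : S'.Answers B :=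
  ⟨fun hB => hr.trans (h.1 (hAB.2 hB)), fun hB => hr.trans (h.2 fun hA => hB (hAB.1 hA))⟩

theorem ramRuns_check {S : RamState} {A : Prop} {p q : ℕ} (h : S.Answers A) :
    RamRuns W (.ite (.eq p q) .skip (.instr (.const 0 0))) S 2 (fun S' => S'.mem = S.mem ∧
      S'.Answers (A ∧ S.reg p = S.reg q) ∧ ∀ r, r ≠ 0 → S'.reg r = S.reg r) := by
  refine RamRuns.ite (N := 1) (fun hb => (RamRuns.skip ?_).mono (Nat.zero_le 1) fun _ h => h)
    fun hb => RamRuns.instr (by simp [RamInstr.value]) ?_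
  · exact ⟨rfl, h.and_of_ite (fun _ => rfl) (fun hb' => absurd hb hb'), fun _ _ => rfl⟩
  · refine ⟨rfl, h.and_of_ite (fun hb' => absurd hb' hb) (fun _ => ?_), fun r hr => ?_⟩
    · simp [RamInstr.apply, RamInstr.value, RamState.setReg_reg]
    · simp [RamInstr.apply, RamState.setReg_reg, hr]

theorem ramRuns_coverLoop (hW : adjOffset adj n + n ≤ W) (hS : IsGraphState adj t M S) {A : Prop}
    (hA : S.Answers A) :
    RamRuns W coverLoop S (((adj t).map fun u => 7 * (adj u).length + 9 + 3).sum + 5) (fun S' =>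
      S'.Answers (A ∧ ∀ u ∈ adj t, (adj u).countP (· ∈ M) = (adj u).length)) := by
  refine (ramRuns_adjLoop (t := t) hW (by decide) (by decide) (by decide) (by decide) (by decide) (by decide)
    (fun pre S' => IsGraphState adj t M S' ∧
      S'.Answers (A ∧ ∀ u ∈ pre, (adj u).countP (· ∈ M) = (adj u).length))
    (fun u => 7 * (adj u).length + 9) ?_ ?_ ?_ ?_ hS.target hS.two).mono le_rfl fun _ h => h.2
  · rintro pre S' ⟨h, -⟩
    exact ⟨h.one, _, h.mem⟩
  · rintro pre S' S'' ⟨h, hA⟩ hm hr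
    exact ⟨h.of_reg_eq (hm.trans h.mem) fun r _ _ => hr r (by omega) (by omega) (by omega),
      hA.congr (hr 0 (by omega) (by omega) (by omega)) Iff.rfl⟩
  · rintro pre v post - S₁ ⟨h, hA⟩ hv
    refine RamRuns.seq (N := 7 * (adj v).length + 7) (N' := 2) (ramRuns_countLoop hW h hv) ?_
    rintro S₂ ⟨hm, h14, h15, hr⟩
    refine (ramRuns_check (hA.congr (S' := S₂) (hr 0 (by omega)) Iff.rfl)).mono le_rfl ?_
    rintro S₃ ⟨hm', hA', hr'⟩
    refine ⟨(hr' 6 (by omega)).trans (hr 6 (by omega)), (hr' 7 (by omega)).trans (hr 7 (by omega)),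
      h.of_reg_eq (hm'.trans hm) fun r _ _ => (hr' r (by omega)).trans (hr r (by omega)),
      hA'.congr rfl ?_⟩
    rw [h14, h15]
    simp only [List.forall_mem_append, List.forall_mem_singleton]
    tauto
  · exact ⟨hS, hA.congr rfl (by simp)⟩

/-- Registers `16` and `17` hold a vertex of `l` of maximum degree and its degree. -/
def IsMaxDegreeState (adj : Fin n → List (Fin n)) (l : List (Fin n)) (S : RamState) : Prop :=
  ∃ s ∈ l, S.reg 16 = s ∧ S.reg 17 = (adj s).length ∧ ∀ u ∈ l, (adj u).length ≤ (adj s).length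

theorem ramRuns_cliqueLoop (hW : adjOffset adj n + n ≤ W) (hS : IsGraphState adj t M S)
    (hA : S.Answers True) {d : ℕ} (hd : S.reg 5 = d) (hmax : IsMaxDegreeState adj [t] S) :
    RamRuns W cliqueLoop S (((adj t).map fun u => 7 * (adj u).length + 12 + 3).sum + 5) (fun S' =>
      IsGraphState adj t M S' ∧ IsMaxDegreeState adj (t :: adj t) S' ∧
        S'.Answers (∀ u ∈ adj t, (adj u).countP (· ∈ M) = d)) := by
  have hlast := adjOffset_last adj
  refine (ramRuns_adjLoop (t := t) hW (by decide) (by decide) (by decide) (by decide) (by decide) (by decide)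
    (fun pre S' => IsGraphState adj t M S' ∧ IsMaxDegreeState adj (t :: pre) S' ∧
      S'.Answers (∀ u ∈ pre, (adj u).countP (· ∈ M) = d) ∧ S'.reg 5 = d)
    (fun u => 7 * (adj u).length + 12) ?_ ?_ ?_ ?_ hS.target hS.two).mono le_rfl
    fun _ h => ⟨h.1, h.2.1, h.2.2.1⟩
  · rintro pre S' ⟨h, -⟩
    exact ⟨h.one, _, h.mem⟩
  · rintro pre S' S'' ⟨h, ⟨s, hs, h16, h17, hs'⟩, hA, h5⟩ hm hr
    exact ⟨h.of_reg_eq (hm.trans h.mem) fun r _ _ => hr r (by omega) (by omega) (by omega),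
      ⟨s, hs, (hr 16 (by omega) (by omega) (by omega)).trans h16,
        (hr 17 (by omega) (by omega) (by omega)).trans h17, hs'⟩,
      hA.congr (hr 0 (by omega) (by omega) (by omega)) Iff.rfl,
      (hr 5 (by omega) (by omega) (by omega)).trans h5⟩
  · rintro pre v post - S₁ ⟨h, ⟨s, hs, h16, h17, hs'⟩, hA, h5⟩ hv
    refine RamRuns.seq (N := 7 * (adj v).length + 7) (N' := 2 + 3)
      (ramRuns_countLoop hW h hv) ?_
    rintro S₂ ⟨hm, h14, h15, hr⟩
    refine RamRuns.seq (N := 2) (ramRuns_check (hA.congr (S' := S₂) (hr 0 (by omega)) Iff.rfl)) ?_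
    rintro S₃ ⟨hm', hA', hr'⟩
    have hreg : ∀ r, r ≠ 0 → r < 9 ∨ 15 < r → S₃.reg r = S₁.reg r := fun r h0 h =>
      (hr' r h0).trans (hr r h)
    have hA₃ : S₃.Answers (∀ u ∈ pre ++ [v], (adj u).countP (· ∈ M) = d) := by
      refine hA'.congr rfl ?_
      rw [h14, hr 5 (by omega), h5]
      simp only [List.forall_mem_append, List.forall_mem_singleton]
    have h₃ : IsGraphState adj t M S₃ :=
      h.of_reg_eq (hm'.trans hm) fun r _ _ => hreg r (by omega) (by omega)
    have h15' : S₃.reg 15 = (adj v).length := (hr' 15 (by omega)).trans h15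
    have h17' : S₃.reg 17 = (adj s).length := (hreg 17 (by omega) (by omega)).trans h17
    have h8' : S₃.reg 8 = v := (hreg 8 (by omega) (by omega)).trans hv
    have hle := adjOffset_add_length_le adj v
    have hvn := v.2
    refine RamRuns.ite (N := 1 + 1) (fun hb => ?_)
      fun hb => (RamRuns.skip ?_).mono (Nat.zero_le 2) fun _ h => h
    · simp only [RamTest.Holds, h15', h17'] at hb
      refine RamRuns.instr_seq ?_ <| RamRuns.instr ?_ ?_
      · simp only [RamInstr.value, h15']
        omega
      · simp [RamInstr.value, RamInstr.apply, RamState.setReg_reg, h8']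
        omega
      · refine ⟨by simp [RamInstr.apply, RamState.setReg_reg, hreg 6],
          by simp [RamInstr.apply, RamState.setReg_reg, hreg 7],
          h₃.of_reg_eq (by simpa [RamInstr.apply, RamState.setReg_mem] using h₃.mem) ?_,
          ⟨v, by simp, by simp [RamInstr.value, RamInstr.apply, RamState.setReg_reg, h8'],
            by simp [RamInstr.value, RamInstr.apply, RamState.setReg_reg, h15'], ?_⟩,
          hA₃.congr (by simp [RamInstr.apply, RamState.setReg_reg]) Iff.rfl,
          by simp [RamInstr.apply, RamState.setReg_reg, hreg 5, h5]⟩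
        · intro r _ _
          simp only [RamInstr.apply, RamState.setReg_reg]
          rw [if_neg (by omega), if_neg (by omega)]
        · intro u hu
          rw [← List.cons_append, List.mem_append, List.mem_singleton] at hu
          rcases hu with hu | rfl
          · exact (hs' u hu).trans hb.le
          · exact le_rfl
    · simp only [RamTest.Holds, h15', h17', not_lt] at hb
      refine ⟨hreg 6 (by omega) (by omega), hreg 7 (by omega) (by omega), h₃,
        ⟨s, ?_, (hreg 16 (by omega) (by omega)).trans h16, h17', ?_⟩, hA₃,
        (hreg 5 (by omega) (by omega)).trans h5⟩
      · rw [← List.cons_append]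
        exact List.mem_append_left _ hs
      · intro u hu
        rw [← List.cons_append, List.mem_append, List.mem_singleton] at hu
        rcases hu with hu | rfl
        · exact hs' u hu
        · exact hb
  · exact ⟨hS, hmax, hA.congr rfl (by simp), hd⟩

theorem ramRuns_initProgram (hW : adjOffset adj n + n ≤ W) :
    RamRuns W initProgram (initialState (graphInput adj t)) 9 (fun S' =>
      IsGraphState adj t {t} S' ∧ S'.Answers True) := by
  have hlast := adjOffset_last adj
  have htn := t.2
  have hm := initialState_mem adj t
  have h0 : (initialState (graphInput adj t)).mem 0 = n := by rw [hm, markedMemory_zero]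
  have h1 : (initialState (graphInput adj t)).mem 1 = t := by rw [hm, markedMemory_one]
  have hB : (initialState (graphInput adj t)).mem (n + 2) = adjOffset adj n := by
    rw [hm, markedMemory_offset _ le_rfl]
  have hr : ∀ r, (initialState (graphInput adj t)).reg r = 0 := fun _ => rfl
  generalize initialState (graphInput adj t) = S at *
  refine RamRuns.instr_seq (N := 1 + (1 + (1 + (1 + (1 + (1 + (1 + 1))))))) ?_ <|
    RamRuns.instr_seq ?_ <| RamRuns.instr_seq ?_ <| RamRuns.instr_seq ?_ <|
    RamRuns.instr_seq ?_ <| RamRuns.instr_seq ?_ <| RamRuns.instr_seq ?_ <|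
    RamRuns.instr_seq ?_ <| RamRuns.instr ?_ ⟨⟨?_, ?_, ?_, ?_, ?_⟩, ?_, ?_⟩
  all_goals simp [RamInstr.value, RamInstr.apply, RamState.setReg_reg, RamState.setReg_mem,
    RamState.setMem_reg, RamState.setMem_mem, hr, h0, h1, hB]
  any_goals omega
  rw [hm, markedMemory_update]
  rfl

/-- The condition that `endVertexProgram` checks, for the vertex `s` in register `16`. -/
def IsCliqueCovered (adj : Fin n → List (Fin n)) (t s : Fin n) : Prop :=
  (∀ u ∈ adj t, (adj u).countP (· ∈ {t} ∪ (adj t).toFinset) = (adj t).length) ∧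
    ∀ u ∈ adj t, (adj u).countP (· ∈ {t} ∪ (adj t).toFinset ∪ (adj s).toFinset) = (adj u).length

theorem ramRuns_endVertexProgram (hW : adjOffset adj n + n ≤ W) {N : ℕ}
    (hN : ∀ s, (6 * (adj t).length + 6) + (((adj t).map fun u => 7 * (adj u).length + 15).sum + 5)
      + (6 * (adj s).length + 6) + (((adj t).map fun u => 7 * (adj u).length + 12).sum + 5) + 12
        ≤ N) :
    RamRuns W endVertexProgram (initialState (graphInput adj t)) N (fun S' =>
      ∃ s ∈ t :: adj t, (∀ u ∈ t :: adj t, (adj u).length ≤ (adj s).length) ∧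
        S'.Answers (IsCliqueCovered adj t s)) := by
  -- The vertex in register `16` is known only after the clique check, so a longest list overall
  -- bounds the cost of marking its neighbours.
  obtain ⟨s₀, -, hs₀⟩ := Finset.exists_max_image Finset.univ (fun s => (adj s).length)
    ⟨t, Finset.mem_univ t⟩
  have hlast := adjOffset_last adj
  have hle := adjOffset_add_length_le adj t
  have htn := t.2
  refine RamRuns.mono (N := 9 + ((6 * (adj t).length + 6) + (1 + (1 + (1 +
    ((((adj t).map fun u => 7 * (adj u).length + 15).sum + 5) + ((6 * (adj s₀).length + 6) +
      (((adj t).map fun u => 7 * (adj u).length + 12).sum + 5))))))))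
    ((ramRuns_initProgram hW).seq ?_) (by have := hN s₀; omega) (fun _ h => h)
  rintro S₁ ⟨h₁, hA₁⟩
  refine (ramRuns_markLoop hW h₁ (by omega) h₁.target).seq ?_
  rintro S₂ ⟨hm₂, h15, hr₂⟩
  have h₂ := h₁.of_reg_eq hm₂ fun r _ _ => hr₂ r (by omega)
  have hA₂ : S₂.Answers True := hA₁.congr (hr₂ 0 (by omega)) Iff.rfl
  refine RamRuns.instr_seq ?_ <| RamRuns.instr_seq ?_ <| RamRuns.instr_seq ?_ <|
    (ramRuns_cliqueLoop hW (d := (adj t).length) (h₂.of_reg_eq (M' := {t} ∪ (adj t).toFinset) ?_ ?_)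
      (hA₂.congr ?_ Iff.rfl) ?_ ⟨t, by simp, ?_, ?_, by simp⟩).seq ?_
  · simp only [RamInstr.value, h15]; omega
  · simp [RamInstr.value, RamInstr.apply, RamState.setReg_reg, h15]; omega
  · simp [RamInstr.value, RamInstr.apply, RamState.setReg_reg, h₂.target]; omega
  · simpa only [RamInstr.apply, RamState.setReg_mem] using hm₂
  · intro r _ _
    simp only [RamInstr.apply, RamState.setReg_reg]
    rw [if_neg (by omega), if_neg (by omega), if_neg (by omega)]
  · simp [RamInstr.apply, RamState.setReg_reg]
  · simp [RamInstr.value, RamInstr.apply, RamState.setReg_reg, h15]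
  · simp [RamInstr.value, RamInstr.apply, RamState.setReg_reg, h₂.target]
  · simp [RamInstr.value, RamInstr.apply, RamState.setReg_reg, h15]
  · rintro S₃ ⟨h₃, ⟨s, hs, h16, -, hmax⟩, hA₃⟩
    have hss : (adj s).length ≤ (adj s₀).length := hs₀ s (Finset.mem_univ s)
    refine RamRuns.seq (N := 6 * (adj s₀).length + 6)
      ((ramRuns_markLoop hW h₃ (by omega) h16).mono (by omega) fun _ h => h) ?_
    rintro S₄ ⟨hm₄, -, hr₄⟩
    exact (ramRuns_coverLoop hW (h₃.of_reg_eq hm₄ fun r _ _ => hr₄ r (by omega))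
      (hA₃.congr (hr₄ 0 (by omega)) Iff.rfl)).mono le_rfl fun S₅ hA₅ => ⟨s, hs, hmax, hA₅⟩

end Specifications

/-! ## Correctness and running time of the program -/

namespace IsIndifferenceRep

variable {V : Type*} {G : SimpleGraph V} {a : V → ℝ} {ℓ : ℝ} {t s : V}

/-- An edge leaving the set of vertices too far left of `t` ends in `N(t)`, being too short to pass
over `t`. -/
theorem exists_left_neighbor (h : IsIndifferenceRep G a ℓ) (hG : G.Preconnected) {p : V}
    (hp : a p + ℓ < a t) : ∃ x q, G.Adj t x ∧ G.Adj x q ∧ a q + ℓ < a t := by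
  obtain ⟨q, x, hqx, hq, hx⟩ := exists_adj_of_not hG (fun v => a v + ℓ < a t) (v := t) hp
    (by have := h.1; linarith)
  have hqx' := (h.2 _ _).1 hqx
  refine ⟨x, q, (h.2 _ _).2 ⟨?_, ?_, ?_⟩, hqx.symm, hq⟩
  · rintro rfl; linarith
  · linarith
  · linarith [h.1]

/-- Every vertex of `N[t]` reaches everything on its right. If `u` reached `w` on the left and `s`
did not, then `N[s]` would be a proper subset of `N[u]`, against the choice of `s`. -/
theorem covered_of_isRightEnd [Finite V] (h : IsIndifferenceRep G a ℓ) (ht : IsRightEnd a ℓ t)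
    (hst : s ∈ insert t (G.neighborSet t)) {u w : V}
    (hmax : (G.neighborSet u).ncard ≤ (G.neighborSet s).ncard) (hu : G.Adj t u)
    (huw : G.Adj u w) (hw : w ∉ insert t (G.neighborSet t)) : G.Adj s w := by
  have hl := h.1
  by_contra hsw
  have hu' := h.mem_closedNbhd.1 (Set.mem_insert_of_mem _ hu)
  have hst' := h.mem_closedNbhd.1 hst
  have huw' := (h.2 _ _).1 huw
  have hwt : a w + ℓ < a t := by
    by_contra hcon
    exact hw (h.mem_closedNbhd.2 ⟨ht t w (by linarith) (by linarith), not_lt.1 hcon⟩)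
  have hws : a w + ℓ < a s := by
    by_contra hcon
    refine hsw ((h.2 _ _).2 ⟨?_, not_lt.1 hcon, by linarith⟩)
    rintro rfl
    exact hw hst
  have hlt : (insert s (G.neighborSet s)).ncard < (insert u (G.neighborSet u)).ncard := by
    refine Set.ncard_lt_ncard ⟨fun z hz => ?_, fun hss => ?_⟩ (Set.toFinite _)
    · have hz' := h.mem_closedNbhd.1 hz
      exact h.mem_closedNbhd.2 ⟨ht u z hu'.1 hu'.2, by linarith⟩
    · have := h.mem_closedNbhd.1 (hss (Set.mem_insert_of_mem _ huw))
      linarith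
  rw [Set.ncard_insert_of_notMem (by simp) (Set.toFinite _),
    Set.ncard_insert_of_notMem (by simp) (Set.toFinite _)] at hlt
  omega

theorem simplicialWithConnectedRest_iff_covered [Finite V] (h : IsIndifferenceRep G a ℓ)
    (hG : G.Preconnected) (hst : s ∈ insert t (G.neighborSet t))
    (hmax : ∀ u ∈ insert t (G.neighborSet t),
      (G.neighborSet u).ncard ≤ (G.neighborSet s).ncard) :
    IsSimplicialWithConnectedRest G t ↔ IsSimplicialVertex G t ∧
      ∀ u w, G.Adj t u → G.Adj u w → w ∉ insert t (G.neighborSet t) → G.Adj s w := by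
  constructor
  · intro ht
    refine ⟨ht.1, fun u w hu huw hw => ?_⟩
    have hmu := hmax u (Set.mem_insert_of_mem _ hu)
    rcases (h.simplicialWithConnectedRest_iff hG).1 ht with hr | hr
    · exact h.covered_of_isRightEnd hr hst hmu hu huw hw
    · exact h.neg.covered_of_isRightEnd hr hst hmu hu huw hw
  · rintro ⟨hs, hcov⟩
    refine (h.simplicialWithConnectedRest_iff hG).2 (h.isRightEnd_or_of_oneSided hs ?_)
    by_contra! hcon
    obtain ⟨⟨p, hp⟩, q, hq⟩ := hcon
    -- Both `p'` and `q'`, on opposite sides of `N[t]`, would be adjacent to `s` although they are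
    -- more than `2ℓ` apart.
    obtain ⟨x, p', hx, hxp, hp'⟩ := h.exists_left_neighbor hG hp
    obtain ⟨y, q', hy, hyq, hq'⟩ := h.neg.exists_left_neighbor hG (p := q) (t := t) (by linarith)
    have h1 := (h.2 _ _).1 (hcov x p' hx hxp fun hm => by
      linarith [(h.mem_closedNbhd.1 hm).2])
    have h2 := (h.2 _ _).1 (hcov y q' hy hyq fun hm => by
      linarith [(h.mem_closedNbhd.1 hm).1])
    linarith

end IsIndifferenceRep

/-! ### From counts in adjacency lists to the graph. -/

section AdjacencyLists

variable {n : ℕ} {G : SimpleGraph (Fin n)} {adj : Fin n → List (Fin n)} {t u s : Fin n}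

theorem IsAdjacencyList.neighborSet_eq (h : IsAdjacencyList G adj) (v : Fin n) :
    G.neighborSet v = (adj v).toFinset := by
  ext w
  simp [(h v).2]

theorem IsAdjacencyList.length_eq (h : IsAdjacencyList G adj) (v : Fin n) :
    (adj v).length = (G.neighborSet v).ncard := by
  rw [h.neighborSet_eq, Set.ncard_coe_finset, List.toFinset_card_of_nodup (h v).1]

theorem IsAdjacencyList.sum_length (h : IsAdjacencyList G adj) :
    ∑ v, (adj v).length = 2 * G.edgeSet.ncard := by
  classical
  rw [← SimpleGraph.coe_edgeFinset, Set.ncard_coe_finset, ← G.sum_degrees_eq_twice_card_edges]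
  refine Finset.sum_congr rfl fun v _ => ?_
  rw [h.length_eq, ← SimpleGraph.card_neighborFinset_eq_degree, ← Set.ncard_coe_finset,
    SimpleGraph.coe_neighborFinset]

/-- The counted vertices lie in `N[t]` without `u`, a set of size `deg t`, so equality of the counts
means that all of it is adjacent to `u`. -/
theorem IsAdjacencyList.countP_eq_iff (h : IsAdjacencyList G adj) (hu : G.Adj t u) :
    (adj u).countP (· ∈ {t} ∪ (adj t).toFinset) = (adj t).length ↔
      ∀ w ∈ insert t (G.neighborSet t), u ≠ w → G.Adj u w := by
  have hmem : ∀ w, w ∈ {t} ∪ (adj t).toFinset ↔ w ∈ insert t (G.neighborSet t) := by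
    intro w
    simp [(h t).2]
  have hcard : (({t} ∪ (adj t).toFinset).erase u).card = (adj t).length := by
    rw [Finset.card_erase_of_mem ((hmem u).2 (Set.mem_insert_of_mem _ hu)),
      ← Finset.insert_eq, Finset.card_insert_of_notMem (by simp [(h t).2]),
      List.toFinset_card_of_nodup (h t).1, Nat.add_sub_cancel]
  have hsub : ((adj u).filter (· ∈ {t} ∪ (adj t).toFinset)).toFinset ⊆
      ({t} ∪ (adj t).toFinset).erase u := by
    intro w hw
    rw [List.mem_toFinset, List.mem_filter, decide_eq_true_iff, (h u).2] at hw
    exact Finset.mem_erase.2 ⟨hw.1.ne', hw.2⟩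
  rw [List.countP_eq_length_filter, ← List.toFinset_card_of_nodup ((h u).1.filter _), ← hcard]
  constructor
  · intro heq w hw huw
    have hw' : w ∈ ({t} ∪ (adj t).toFinset).erase u :=
      Finset.mem_erase.2 ⟨huw.symm, (hmem w).2 hw⟩
    rw [← Finset.eq_of_subset_of_card_le hsub heq.ge, List.mem_toFinset, List.mem_filter,
      (h u).2] at hw'
    exact hw'.1
  · intro hall
    congr 1
    refine hsub.antisymm fun w hw => ?_
    rw [Finset.mem_erase] at hw
    rw [List.mem_toFinset, List.mem_filter, decide_eq_true_iff, (h u).2]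
    exact ⟨hall w ((hmem w).1 hw.2) hw.1.symm, hw.2⟩

theorem IsAdjacencyList.isCliqueCovered_iff (h : IsAdjacencyList G adj) :
    IsCliqueCovered adj t s ↔ IsSimplicialVertex G t ∧
      ∀ u w, G.Adj t u → G.Adj u w → w ∉ insert t (G.neighborSet t) → G.Adj s w := by
  refine and_congr ?_ ?_
  · constructor
    · intro hall u hu w hw huw
      exact (h.countP_eq_iff hu).1 (hall u (((h t).2 u).2 hu)) w (Set.mem_insert_of_mem _ hw) huw
    · intro hs u hu
      have hu' := ((h t).2 u).1 hu
      refine (h.countP_eq_iff hu').2 fun w hw huw => ?_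
      rcases hw with rfl | hw
      · exact hu'.symm
      · exact hs hu' hw huw
  · simp only [List.countP_eq_length, decide_eq_true_iff, Finset.mem_union, Finset.mem_singleton,
      List.mem_toFinset, (h _).2, Set.mem_insert_iff, SimpleGraph.mem_neighborSet]
    constructor
    · intro hall u w hu huw hw
      exact (hall u hu w huw).resolve_left hw
    · intro hall u hu w huw
      exact or_iff_not_imp_left.2 (hall u w hu huw)

theorem IsAdjacencyList.isCliqueCovered_iff_simplicialWithConnectedRest
    (h : IsAdjacencyList G adj) (hK : IsUnitIntervalGraph G) (hG : G.Preconnected)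
    (hs : s ∈ t :: adj t) (hmax : ∀ u ∈ t :: adj t, (adj u).length ≤ (adj s).length) :
    IsCliqueCovered adj t s ↔ IsSimplicialWithConnectedRest G t := by
  obtain ⟨a, ℓ, hrep⟩ := hK.exists_indifferenceRep
  have hmem : ∀ w, w ∈ insert t (G.neighborSet t) ↔ w ∈ t :: adj t := by
    intro w
    simp [(h t).2]
  rw [h.isCliqueCovered_iff, hrep.simplicialWithConnectedRest_iff_covered hG ((hmem s).2 hs)]
  intro u hu
  rw [← h.length_eq, ← h.length_eq]
  exact hmax u ((hmem u).1 hu)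

/-- The entries of `adj t` are distinct, so their degrees sum to at most `2m`; this keeps the nested
loops linear. -/
theorem IsAdjacencyList.sum_map_le (h : IsAdjacencyList G adj) (t : Fin n) (c : ℕ) :
    ((adj t).map fun u => 7 * (adj u).length + c).sum ≤ 14 * G.edgeSet.ncard + c * n := by
  rw [← List.sum_toFinset _ (h t).1]
  refine (Finset.sum_le_sum_of_subset (Finset.subset_univ _)).trans ?_
  rw [Finset.sum_add_distrib, ← Finset.mul_sum, h.sum_length]
  simp
  ring_nf
  exact le_rfl

theorem IsAdjacencyList.length_le (h : IsAdjacencyList G adj) (v : Fin n) :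
    (adj v).length ≤ n := by
  rw [← List.toFinset_card_of_nodup (h v).1]
  exact (Finset.card_le_univ _).trans_eq (Fintype.card_fin n)

end AdjacencyLists

theorem endVertexProgram_decides (Q : ∀ n : ℕ, SimpleGraph (Fin n) → Fin n → Prop)
    (hQ : ∀ (n : ℕ) (G : SimpleGraph (Fin n)) (t : Fin n), G.Connected → IsUnitIntervalGraph G →
      (Q n G t ↔ IsSimplicialWithConnectedRest G t)) :
    DecidesInLinearTime endVertexProgram (fun _ G => IsUnitIntervalGraph G) Q := by
  -- A generous constant: the cost is at most `28m + 39n + 34`, addresses stay below `2m + 2n + 3`,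
  -- and `n` is positive.
  refine ⟨100, fun n G t adj hG hK hadj => ?_⟩
  have hn : 0 < n := t.pos
  have hB := adjOffset_last adj
  rw [hadj.sum_length] at hB
  have ht := hadj.length_le t
  have h15 := hadj.sum_map_le t 15
  have h12 := hadj.sum_map_le t 12
  obtain ⟨T, S, hT, hle, s, hs, hmax, hA⟩ := ramRuns_endVertexProgram (t := t) (adj := adj)
    (W := 100 * (n + G.edgeSet.ncard)) (by omega) (N := 100 * (n + G.edgeSet.ncard))
    (fun s => by have := hadj.length_le s; omega)
  have hiff := (hadj.isCliqueCovered_iff_simplicialWithConnectedRest hK hG.preconnected hs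
    hmax).trans (hQ n G t hG hK).symm
  exact ⟨T, S, hT, hle, fun hq => hA.1 (hiff.2 hq), fun hq => hA.2 fun hc => hq (hiff.1 hc)⟩

theorem mainTheorem9 :
    ∃ P : RamProgram,
      DecidesInLinearTime P (fun _ G => IsUnitIntervalGraph G) (fun _ G t => IsMCSEndVertex G t) ∧
      DecidesInLinearTime P (fun _ G => IsUnitIntervalGraph G) (fun _ G t => IsLDFSEndVertex G t) ∧
      DecidesInLinearTime P (fun _ G => IsUnitIntervalGraph G)
        (fun _ G t => IsSimplicialWithConnectedRest G t) :=
  ⟨endVertexProgram,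
    endVertexProgram_decides _ fun _ _ _ hG hK => hK.isMCSEndVertex_iff hG.preconnected,
    endVertexProgram_decides _ fun _ _ _ hG hK => hK.isLDFSEndVertex_iff hG.preconnected,
    endVertexProgram_decides _ fun _ _ _ _ _ => Iff.rfl⟩
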